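/- Notation. All functions are $2\pi$-periodic in $x$, $\hat f_k=\frac1{2\pi}\int_0^{2\pi}f(x)e^{-ikx}\,dx$, $\|f\|_2^2=\int_0^{2\pi}|f|^2dx$, and $B[z_1,z_2,z_3,z_4,z_5]=z_1z_2^*z_3z_4^*z_5$ ($*$ is complex conjugation). For $N\in\mathbb N$ let $F_N=\{k\in\mathbb Z:-\frac N2\le k<\frac N2\}$ (so $F_N=[-\frac N2,\frac N2-1]$ for even $N$), and let $P_N$ be the projection $P_Nf=\sum_{k\in F_N}\hat f_ke^{ikx}$; put $P_\infty=\mathrm{id}$. Full system. Let $T>0$. For every $N$ let $M_N\in\mathbb N\cup\{\infty\}$ with $M_N\ge N$ be the number of modes of the full system (for instance $M_N=\infty$, or $M_N=2N$), and let $u=u_N(t,x)$ be a $C^\infty$ solution on $[0,T]\times\mathbb R$ of the critical focusing Schrödinger equation $$iu_t+u_{xx}+P_{M_N}(|u|^4u)=0,\qquad u=P_{M_N}u .$$ For $M_N=\infty$ this is the equation $iu_t+u_{xx}+|u|^4u=0$ itself, and $u_N$ may be one fixed smooth solution $u$; for $M_N<\infty$ it is the system truncated to the modes in $F_{M_N}$.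 Smoothness is uniform in $N$: for each $m$, $\sup_{N,\,t\in[0,T],\,x}|\partial_x^mu_N(t,x)|<\infty$ (automatic if $u_N=u$ does not depend on $N$). Write $P=P_N$ and $Q=I-P=P_{M_N}-P_N$ for the projection on the unresolved modes of the full system. $t$-model. Let $v(t,x)=\sum_{k\in F_N}v_k(t)e^{ikx}$ solve, on $[0,T]$, the $t$-model $$\partial_tv=iv_{xx}+iPB[v,v,v,v,v]+3it\,PB[\Gamma,v,v,v,v]+2it\,PB[v,\Gamma,v,v,v],\qquad \Gamma=i(I-P)B[v,v,v,v,v].$$ Claim. (a) There are constants $C_4,C_5,C_6\ge0$ independent of $N$, and constants $C_1(N),C_2(N),C_3(N)\ge0$ growing at most polynomially in $N$, such that for every $N$ and every solution $v$ of the $t$-model on $[0,T]$ with $v(0)=Pu(0)$, the function $\|v-Pu\|_2^2$ is differentiable on $[0,T]$ (one-sided at the end points) and, for all $t\in[0,T]$, $$\frac{d}{dt}\frac12\|v-Pu\|_2^2\le tC_1(N)\big(\|v-Pu\|_2^2\big)^4+tC_2(N)\big(\|v-Pu\|_2^2\big)^3+tC_3(N)\big(\|v-Pu\|_2^2\big)^2+(C_4+tC_5)\|v-Pu\|_2^2+C_6\|Qu\|_2^2+1664\,t\,\|(I-P)B[Pu,Pu,Pu,Pu,Pu]\|_2^2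 .$$ (b) The $t$-model converges: $\|v-Pu\|_2^2\to0$ as $N\to\infty$, uniformly for $t\in[0,T]$, for the solutions $v$ with $v(0)=Pu(0)$. (c) For every solution $v$ of the $t$-model on $[0,T]$ (whatever its initial value) the last term in (a) has the same form as the decay rate of the $L_2$ norm of $v$: for all $t\in[0,T]$, $$\frac{d}{dt}\frac12\|v\|_2^2=-t\,\|(I-P)B[v,v,v,v,v]\|_2^2=-t\,\|\Gamma\|_2^2 .$$ -/

import Mathlib

open Set Filter Topology MeasureTheory
open scoped ContDiff

namespace NLS

/-- The resolved modes: `F N = [-N/2, N/2 - 1]` for even `N` (and `[-(N-1)/2, (N-1)/2]` for odd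
`N`), a set of `N` consecutive integers. -/
noncomputable def F (N : ℕ) : Finset ℤ := Finset.Ico (-((N : ℤ) / 2)) (((N : ℤ) + 1) / 2)

/-- The exponential `x ↦ e^{ikx}`. -/
noncomputable def expo (k : ℤ) (x : ℝ) : ℂ := Complex.exp (Complex.I * k * x)

/-- The `k`-th Fourier coefficient `(2π)⁻¹ ∫_0^{2π} f(x) e^{-ikx} dx`. -/
noncomputable def coeff (f : ℝ → ℂ) (k : ℤ) : ℂ :=
  (2 * Real.pi : ℂ)⁻¹ * ∫ x in (0 : ℝ)..(2 * Real.pi), f x * expo (-k) x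

/-- The trigonometric sum `∑_{k ∈ S} a_k e^{ikx}`. -/
noncomputable def trigSum (S : Finset ℤ) (a : ℤ → ℂ) (x : ℝ) : ℂ := ∑ k ∈ S, a k * expo k x

/-- The projection onto the modes in `F M` if `M` is finite, and the identity if `M = ∞`. -/
noncomputable def proj (M : ℕ∞) (f : ℝ → ℂ) : ℝ → ℂ :=
  ENat.recTopCoe (C := fun _ => ℝ → ℂ) f (fun m => trigSum (F m) (coeff f)) M

/-- The complementary projection `Q = I - P`, where `P` projects onto the `N` resolved modes and
`I` is the identity on the space of all modes `F ∪ G` of the full system, which has `M` modes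
(`M = ∞`: all integers). -/
noncomputable def compl (N : ℕ) (M : ℕ∞) (f : ℝ → ℂ) (x : ℝ) : ℂ := proj M f x - proj N f x

/-- `B[z₁,z₂,z₃,z₄,z₅] = z₁ z₂* z₃ z₄* z₅`. -/
noncomputable def B (z₁ z₂ z₃ z₄ z₅ : ℝ → ℂ) (x : ℝ) : ℂ :=
  z₁ x * star (z₂ x) * z₃ x * star (z₄ x) * z₅ x

/-- `B[z,z,z,z,z]`. -/
noncomputable def Bdiag (z : ℝ → ℂ) : ℝ → ℂ := B z z z z z

/-- The squared norm `‖f‖₂² = ∫_0^{2π} |f|² dx`. -/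
noncomputable def normSq (f : ℝ → ℂ) : ℝ := ∫ x in (0 : ℝ)..(2 * Real.pi), ‖f x‖ ^ 2

/-- `u` (as a function of `t`, then `x`) is a smooth `2π`-periodic solution on the time interval
`[0,T]` of the full system `i u_t + u_xx + |u|⁴ u = 0` if `M = ∞`, and of the system truncated to
the modes in `F M`, `i u_t + u_xx + P_M (|u|⁴ u) = 0` with `u = P_M u`, if `M` is finite. -/
structure IsFullSolution (M : ℕ∞) (T : ℝ) (u : ℝ → ℝ → ℂ) : Prop where
  smooth : ContDiffOn ℝ ∞ (fun p : ℝ × ℝ => u p.1 p.2) (Icc 0 T ×ˢ univ)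
  periodic : ∀ t ∈ Icc 0 T, Function.Periodic (u t) (2 * Real.pi)
  modes : ∀ t ∈ Icc 0 T, proj M (u t) = u t
  equation : ∀ t ∈ Icc 0 T, ∀ x : ℝ,
    Complex.I * derivWithin (fun s => u s x) (Icc 0 T) t + iteratedDeriv 2 (u t) x
      + proj M (fun y => (‖u t y‖ : ℂ) ^ 4 * u t y) x = 0

/-- `Γ = i (I - P) B[v,v,v,v,v]`. -/
noncomputable def Gam (N : ℕ) (M : ℕ∞) (v : ℝ → ℂ) (x : ℝ) : ℂ :=
  Complex.I * compl N M (Bdiag v) x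

/-- The function `v(t,·) = ∑_{k ∈ F} a_k(t) e^{ikx}` with the resolved modes `a_k(t)`. -/
noncomputable def resolved (N : ℕ) (a : ℝ → ℤ → ℂ) (t : ℝ) : ℝ → ℂ := trigSum (F N) (a t)

/-- The modes `a t k` (`k ∈ F N`) satisfy the `t`-model on `[0,T]`. With
`v(t,x) = ∑_{k ∈ F} a_k(t) e^{ikx}` and `Γ = i (I - P) B[v,v,v,v,v]` this is the equation
`v_t = i v_xx + i P B[v,v,v,v,v] + 3 i t P B[Γ,v,v,v,v] + 2 i t P B[v,Γ,v,v,v]`,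
read off mode by mode. -/
def IsTModel (N : ℕ) (M : ℕ∞) (T : ℝ) (a : ℝ → ℤ → ℂ) : Prop :=
  ∀ t ∈ Icc 0 T, ∀ v Γ : ℝ → ℂ, v = resolved N a t → Γ = Gam N M v → ∀ k ∈ F N,
    HasDerivWithinAt (fun s => a s k)
      (-Complex.I * (k : ℂ) ^ 2 * a t k + Complex.I * coeff (Bdiag v) k
        + (t : ℂ) * (3 * Complex.I * coeff (B Γ v v v v) k
          + 2 * Complex.I * coeff (B v Γ v v v) k))
      (Icc 0 T) t

/-- The squared error `‖v - Pu‖₂²` at time `t`. -/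
noncomputable def errSq (N : ℕ) (a : ℝ → ℤ → ℂ) (u : ℝ → ℝ → ℂ) (t : ℝ) : ℝ :=
  normSq (fun x => resolved N a t x - proj N (u t) x)

end NLS

/-!
Write `w = P_N u` for the resolved part of the full solution, `e = v - w` for the error and
`E = ‖e‖₂²`. Both `v` and `w` are trigonometric sums on the modes `F N`, and `e` satisfies
`e_t = i e_xx + P (i|v|⁴v - i|u|⁴u + t Df(v)Γ)` with `f(v) = i|v|⁴v` and
`Df(v)Γ = 3i|v|⁴Γ + 2i|v|²v²Γ*`. The dispersive term is skew-adjoint, so `½E` changes at the rate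
`Re ⟨i|v|⁴v - i|u|⁴u + t Df(v)Γ, e⟩` (`hasDerivWithinAt_errSq`).

If `K` bounds `u`, `v` and `w` in the sup norm, pointwise Lipschitz bounds and Young's inequality
give the desired inequality with constants depending on `K` only (`integral_force_le`), where the
memory term contributes `Γ = i(Q(|w|⁴w) + Q(|v|⁴v - |w|⁴w))` and `‖Q‖ ≤ 1`. The sup norms of `u`
and `w` are bounded independently of `N`, because two derivatives of `u` make its Fourier series
absolutely summable (`IsFullSolution.norm_proj_le`). For `v` there are two regimes.

* If `N E ≤ 1`, Bernstein's inequality `‖e‖_∞² ≤ N E` bounds `v` independently of `N`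
  (`errRate_le_of_small`).
* If `N E > 1`, Bernstein's inequality and the decay of `‖v‖₂` bound the rate by some `R`
  polynomial in `N` (`errRate_le_pow`). As `E` vanishes initially, `N⁻¹ < E ≤ 2Rt`, hence
  `R ≤ R (N E)³ ≤ 2 R² N³ t E²`, a term of the allowed form (`le_mul_sq_of_large`). Since `v(0)`
  is the projection of the initial datum, the quadratic term suffices and the cubic and quartic
  ones can be taken to be zero.

For the convergence, `‖Qu‖₂²` and `‖Q(|w|⁴w)‖₂²` are `O(N⁻²)` by Parseval applied to one derivative
(`normSq_sub_trigSum_F_le`). As long as `N E ≤ 1` the inequality is linear in `E`, and a barrier of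
size `O(N⁻²)` never leaves this regime for large `N` (`le_exp_of_conditional_bound`).

The energy identity holds because `Re ⟨Df(v)Γ, v⟩ = -Im ⟨Γ, |v|⁴v⟩` and `Γ = iQ(|v|⁴v)` with `Q` an
orthogonal projection (`IsTModel.energy`).
-/

namespace NLS

/-! ### Fourier coefficients and projections -/

lemma continuous_expo (k : ℤ) : Continuous (expo k) := by
  unfold expo; fun_prop

lemma norm_expo (k : ℤ) (x : ℝ) : ‖expo k x‖ = 1 := by
  have : expo k x = Complex.exp (((k * x : ℝ) : ℂ) * Complex.I) := by
    unfold expo; push_cast; ring_nf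
  rw [this, Complex.norm_exp_ofReal_mul_I]

lemma star_expo (k : ℤ) (x : ℝ) : star (expo k x) = expo (-k) x := by
  unfold expo
  rw [Complex.star_def, ← Complex.exp_conj]
  simp

lemma expo_mul_expo (k l : ℤ) (x : ℝ) : expo k x * expo l x = expo (k + l) x := by
  unfold expo
  rw [← Complex.exp_add]
  push_cast; ring_nf

lemma hasDerivAt_expo (k : ℤ) (x : ℝ) : HasDerivAt (expo k) (Complex.I * k * expo k x) x := by
  unfold expo
  have h := ((Complex.ofRealCLM.hasDerivAt (x := x)).const_mul (Complex.I * (k : ℂ))).cexp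
  simpa [mul_comm] using h

lemma expo_two_pi (k : ℤ) : expo k (2 * Real.pi) = 1 := by
  unfold expo
  rw [Complex.exp_eq_one_iff]
  exact ⟨k, by push_cast; ring⟩

lemma expo_at_zero (k : ℤ) : expo k 0 = 1 := by simp [expo]

lemma integral_expo (k : ℤ) :
    ∫ x in (0 : ℝ)..(2 * Real.pi), expo k x = if k = 0 then (2 * Real.pi : ℂ) else 0 := by
  split_ifs with h
  · subst h
    simp [expo]
  · have hk : Complex.I * (k : ℂ) ≠ 0 := by simp [h]
    have := intervalIntegral.integral_eq_sub_of_hasDerivAt (a := 0) (b := 2 * Real.pi)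
      (fun x _ => hasDerivAt_expo k x)
      ((continuous_const.mul (continuous_expo k)).intervalIntegrable _ _)
    rw [intervalIntegral.integral_const_mul, expo_two_pi, expo_at_zero, sub_self] at this
    exact (mul_eq_zero.mp this).resolve_left hk

lemma two_pi_ofReal_ne_zero : (2 * Real.pi : ℂ) ≠ 0 := by
  exact_mod_cast Real.two_pi_pos.ne'

lemma continuous_trigSum (S : Finset ℤ) (a : ℤ → ℂ) : Continuous (trigSum S a) := by
  unfold trigSum
  exact continuous_finsetSum _ fun k _ => continuous_const.mul (continuous_expo k)

lemma coeff_sub {f g : ℝ → ℂ} (hf : Continuous f) (hg : Continuous g) (k : ℤ) :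
    coeff (fun x => f x - g x) k = coeff f k - coeff g k := by
  unfold coeff
  simp_rw [sub_mul]
  rw [intervalIntegral.integral_sub (f := fun x => f x * expo (-k) x)
    (g := fun x => g x * expo (-k) x) ((hf.mul (continuous_expo _)).intervalIntegrable _ _)
    ((hg.mul (continuous_expo _)).intervalIntegrable _ _), mul_sub]

lemma coeff_add {f g : ℝ → ℂ} (hf : Continuous f) (hg : Continuous g) (k : ℤ) :
    coeff (fun x => f x + g x) k = coeff f k + coeff g k := by
  unfold coeff
  simp_rw [add_mul]
  rw [intervalIntegral.integral_add (f := fun x => f x * expo (-k) x)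
    (g := fun x => g x * expo (-k) x) ((hf.mul (continuous_expo _)).intervalIntegrable _ _)
    ((hg.mul (continuous_expo _)).intervalIntegrable _ _), mul_add]

lemma coeff_const_mul (c : ℂ) (f : ℝ → ℂ) (k : ℤ) :
    coeff (fun x => c * f x) k = c * coeff f k := by
  unfold coeff
  simp_rw [mul_assoc c]
  rw [intervalIntegral.integral_const_mul]
  ring

lemma coeff_trigSum (S : Finset ℤ) (a : ℤ → ℂ) (k : ℤ) :
    coeff (trigSum S a) k = if k ∈ S then a k else 0 := by
  unfold coeff trigSum
  simp_rw [Finset.sum_mul, mul_assoc, expo_mul_expo]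
  rw [intervalIntegral.integral_finsetSum]
  · simp_rw [intervalIntegral.integral_const_mul, integral_expo, mul_ite, mul_zero,
      show ∀ i : ℤ, i + -k = 0 ↔ k = i from fun i => by omega]
    rw [Finset.sum_ite_eq S k (fun i => a i * (2 * Real.pi : ℂ))]
    have := two_pi_ofReal_ne_zero
    split_ifs <;> simp
    field_simp
  · intro i _
    exact (continuous_const.mul (continuous_expo _)).intervalIntegrable _ _

/-- Pairing a function with a trigonometric sum only sees the coefficients on the modes of the
sum. -/
lemma integral_mul_star_trigSum {f : ℝ → ℂ} (hf : Continuous f) (S : Finset ℤ) (a : ℤ → ℂ) :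
    ∫ x in (0 : ℝ)..(2 * Real.pi), f x * star (trigSum S a x)
      = (2 * Real.pi : ℂ) * ∑ k ∈ S, coeff f k * star (a k) := by
  unfold trigSum coeff
  simp_rw [star_sum, star_mul', star_expo, Finset.mul_sum]
  rw [intervalIntegral.integral_finsetSum]
  · refine Finset.sum_congr rfl fun k _ => ?_
    have := two_pi_ofReal_ne_zero
    simp_rw [show ∀ x, f x * (star (a k) * expo (-k) x) = star (a k) * (f x * expo (-k) x) from
      fun x => by ring]
    rw [intervalIntegral.integral_const_mul]
    field_simp
  · intro i _
    exact (hf.mul (continuous_const.mul (continuous_expo _))).intervalIntegrable _ _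

lemma mul_star_self (z : ℂ) : z * star z = ((‖z‖ ^ 2 : ℝ) : ℂ) := by
  rw [Complex.star_def, Complex.mul_conj']; push_cast; rfl

lemma normSq_eq_integral (f : ℝ → ℂ) :
    (normSq f : ℂ) = ∫ x in (0 : ℝ)..(2 * Real.pi), f x * star (f x) := by
  unfold normSq
  simp_rw [mul_star_self]
  rw [intervalIntegral.integral_ofReal]

lemma normSq_nonneg (f : ℝ → ℂ) : 0 ≤ normSq f :=
  intervalIntegral.integral_nonneg Real.two_pi_pos.le fun x _ => by positivity

lemma normSq_mono {f g : ℝ → ℂ} (hf : Continuous f) (hg : Continuous g) {c : ℝ}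
    (h : ∀ x, ‖f x‖ ^ 2 ≤ c * ‖g x‖ ^ 2) : normSq f ≤ c * normSq g := by
  unfold normSq
  rw [← intervalIntegral.integral_const_mul]
  exact intervalIntegral.integral_mono Real.two_pi_pos.le
    ((hf.norm.pow 2).intervalIntegrable _ _)
    ((continuous_const.mul (hg.norm.pow 2)).intervalIntegrable _ _) h

lemma normSq_le_of_norm_le {f : ℝ → ℂ} (hf : Continuous f) {K : ℝ} (h : ∀ x, ‖f x‖ ≤ K) :
    normSq f ≤ 2 * Real.pi * K ^ 2 := by
  have := normSq_mono (g := fun _ => 1) hf continuous_const (c := K ^ 2) fun x => by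
    simpa using pow_le_pow_left₀ (norm_nonneg _) (h x) 2
  simpa [normSq, mul_comm] using this

lemma normSq_trigSum (S : Finset ℤ) (a : ℤ → ℂ) :
    normSq (trigSum S a) = 2 * Real.pi * ∑ k ∈ S, ‖a k‖ ^ 2 := by
  have h := normSq_eq_integral (trigSum S a)
  rw [integral_mul_star_trigSum (continuous_trigSum S a)] at h
  rw [Finset.sum_congr rfl fun k hk => by
    rw [coeff_trigSum, if_pos hk, mul_star_self]] at h
  exact_mod_cast h

lemma norm_add_sq_complex (z w : ℂ) :
    ‖z + w‖ ^ 2 = ‖z‖ ^ 2 + 2 * (z * star w).re + ‖w‖ ^ 2 := by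
  rw [← Complex.normSq_eq_norm_sq, ← Complex.normSq_eq_norm_sq, ← Complex.normSq_eq_norm_sq,
    Complex.normSq_add, Complex.star_def]
  ring

lemma integral_re {f : ℝ → ℂ} (hf : Continuous f) :
    (∫ x in (0 : ℝ)..(2 * Real.pi), f x).re = ∫ x in (0 : ℝ)..(2 * Real.pi), (f x).re :=
  (Complex.reCLM.intervalIntegral_comp_comm (hf.intervalIntegrable _ _)).symm

lemma normSq_add {f g : ℝ → ℂ} (hf : Continuous f) (hg : Continuous g) :
    normSq (fun x => f x + g x) = normSq f
      + 2 * (∫ x in (0 : ℝ)..(2 * Real.pi), f x * star (g x)).re + normSq g := by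
  have hc : Continuous fun x => f x * star (g x) := hf.mul hg.star
  unfold normSq
  simp_rw [norm_add_sq_complex]
  rw [integral_re hc, ← intervalIntegral.integral_const_mul,
    ← intervalIntegral.integral_add, ← intervalIntegral.integral_add]
  all_goals refine Continuous.intervalIntegrable ?_ _ _
  · exact (hf.norm.pow 2).add (continuous_const.mul (Complex.continuous_re.comp hc))
  · exact hg.norm.pow 2
  · exact hf.norm.pow 2
  · exact continuous_const.mul (Complex.continuous_re.comp hc)

/-- Pythagoras for the projection on finitely many modes. -/
lemma normSq_sub_trigSum_coeff {f : ℝ → ℂ} (hf : Continuous f) (S : Finset ℤ) :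
    normSq (fun x => f x - trigSum S (coeff f) x)
      = normSq f - 2 * Real.pi * ∑ k ∈ S, ‖coeff f k‖ ^ 2 := by
  have hT := continuous_trigSum S (coeff f)
  have h := normSq_add (f := fun x => f x - trigSum S (coeff f) x) (hf.sub hT) hT
  have h0 : ∫ x in (0 : ℝ)..(2 * Real.pi), (f x - trigSum S (coeff f) x)
      * star (trigSum S (coeff f) x) = 0 := by
    rw [integral_mul_star_trigSum (f := fun x => f x - trigSum S (coeff f) x) (hf.sub hT),
      Finset.sum_eq_zero, mul_zero]
    intro k hk
    rw [coeff_sub hf hT, coeff_trigSum, if_pos hk, sub_self, zero_mul]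
  simp only [h0, sub_add_cancel] at h
  rw [normSq_trigSum] at h
  simp at h
  linarith

lemma sum_norm_coeff_sq_le {f : ℝ → ℂ} (hf : Continuous f) (S : Finset ℤ) :
    2 * Real.pi * ∑ k ∈ S, ‖coeff f k‖ ^ 2 ≤ normSq f := by
  have := normSq_sub_trigSum_coeff hf S
  have := normSq_nonneg (fun x => f x - trigSum S (coeff f) x)
  linarith

lemma normSq_trigSum_coeff_le {f : ℝ → ℂ} (hf : Continuous f) (S : Finset ℤ) :
    normSq (trigSum S (coeff f)) ≤ normSq f := by
  rw [normSq_trigSum]; exact sum_norm_coeff_sq_le hf S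

lemma norm_coeff_le {f : ℝ → ℂ} {K : ℝ} (h : ∀ x, ‖f x‖ ≤ K) (k : ℤ) :
    ‖coeff f k‖ ≤ K := by
  unfold coeff
  have := intervalIntegral.norm_integral_le_of_norm_le_const (a := 0) (b := 2 * Real.pi)
    (f := fun x => f x * expo (-k) x) (C := K) fun x _ => by
      rw [norm_mul, norm_expo, mul_one]; exact h x
  rw [norm_mul, norm_inv]
  have e : ‖(2 * Real.pi : ℂ)‖ = 2 * Real.pi := by
    simp [abs_of_pos Real.pi_pos]
  rw [sub_zero, abs_of_pos Real.two_pi_pos] at this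
  rw [e, inv_mul_le_iff₀ Real.two_pi_pos]
  linarith

lemma hasSum_norm_coeff_sq {f : ℝ → ℂ} (hf : Continuous f) :
    HasSum (fun k => ‖coeff f k‖ ^ 2) ((2 * Real.pi)⁻¹ * normSq f) := by
  have hm : MemLp f 2 (volume.restrict (Ioc 0 (2 * Real.pi))) :=
    (memLp_two_iff_integrable_sq_norm hf.aestronglyMeasurable).2
      ((intervalIntegrable_iff_integrableOn_Ioc_of_le Real.two_pi_pos.le).1
        ((hf.norm.pow 2).intervalIntegrable _ _))
  have h := hasSum_sq_fourierCoeffOn Real.two_pi_pos hm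
  have hc : ∀ k, fourierCoeffOn Real.two_pi_pos f k = coeff f k := fun k => by
    rw [fourierCoeffOn_eq_integral, coeff, Complex.real_smul]
    congr 1
    · push_cast; simp
    · refine intervalIntegral.integral_congr fun x _ => ?_
      simp only [fourier_coe_apply, smul_eq_mul, expo]
      rw [mul_comm]
      congr 2
      have := two_pi_ofReal_ne_zero
      push_cast
      rw [sub_zero]
      field_simp
  simp_rw [hc] at h
  simpa [normSq] using h

lemma coeff_deriv {f f' : ℝ → ℂ} (hf : ∀ x, HasDerivAt f (f' x) x) (hf' : Continuous f')
    (hp : f (2 * Real.pi) = f 0) (k : ℤ) :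
    coeff f' k = Complex.I * k * coeff f k := by
  have h := intervalIntegral.integral_mul_deriv_eq_deriv_mul (a := 0) (b := 2 * Real.pi)
    (fun x _ => hasDerivAt_expo (-k) x) (fun x _ => hf x)
    ((continuous_const.mul (continuous_expo _)).intervalIntegrable _ _)
    (hf'.intervalIntegrable _ _)
  rw [expo_two_pi, expo_at_zero, hp, sub_self, zero_sub] at h
  unfold coeff
  simp_rw [mul_comm (f' _)]
  rw [h]
  simp_rw [show ∀ x, Complex.I * ((-k : ℤ) : ℂ) * expo (-k) x * f x
    = -(Complex.I * k) * (f x * expo (-k) x) from fun x => by push_cast; ring]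
  rw [intervalIntegral.integral_const_mul]
  ring

lemma card_F (N : ℕ) : (F N).card = N := by
  unfold F
  rw [Int.card_Ico]; omega

lemma F_subset_F {N m : ℕ} (h : N ≤ m) : F N ⊆ F m := by
  unfold F
  apply Finset.Ico_subset_Ico <;> omega

lemma le_two_mul_abs_of_notMem_F {N : ℕ} {k : ℤ} (h : k ∉ F N) : (N : ℤ) ≤ 2 * |k| := by
  unfold F at h
  rw [Finset.mem_Ico, not_and_or] at h
  rcases abs_cases k with ⟨h1, _⟩ | ⟨h1, _⟩ <;> omega

/-- The unresolved part of a `C¹` periodic function is of size `O(1/N)` in `L²`, since each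
coefficient of the derivative on an unresolved mode is at least `N/2` times that of the
function. -/
lemma normSq_sub_trigSum_F_le {f f' : ℝ → ℂ} (hf : ∀ x, HasDerivAt f (f' x) x)
    (hf' : Continuous f') (hp : f (2 * Real.pi) = f 0) (N : ℕ) :
    (N : ℝ) ^ 2 * normSq (fun x => f x - trigSum (F N) (coeff f) x) ≤ 4 * normSq f' := by
  have hfc : Continuous f := continuous_iff_continuousAt.2 fun x => (hf x).continuousAt
  rw [normSq_sub_trigSum_coeff hfc]
  have hpi := Real.two_pi_pos
  have key : (N : ℝ) ^ 2 * ((2 * Real.pi)⁻¹ * normSq f)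
      ≤ (N : ℝ) ^ 2 * ∑ k ∈ F N, ‖coeff f k‖ ^ 2 + 4 * ((2 * Real.pi)⁻¹ * normSq f') := by
    refine hasSum_le_of_sum_le ((hasSum_norm_coeff_sq hfc).mul_left _) fun S => ?_
    have h1 : ∀ k ∈ S, (N : ℝ) ^ 2 * ‖coeff f k‖ ^ 2
        ≤ (if k ∈ F N then (N : ℝ) ^ 2 * ‖coeff f k‖ ^ 2 else 0) + 4 * ‖coeff f' k‖ ^ 2 := by
      intro k _
      split_ifs with hk
      · have : 0 ≤ ‖coeff f' k‖ ^ 2 := by positivity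
        linarith
      · rw [coeff_deriv hf hf' hp, norm_mul, norm_mul, Complex.norm_I, one_mul, zero_add,
          mul_pow, ← mul_assoc]
        gcongr
        have h2 : (N : ℝ) ≤ 2 * |(k : ℝ)| := by exact_mod_cast le_two_mul_abs_of_notMem_F hk
        rw [Complex.norm_intCast]
        nlinarith [(Nat.cast_nonneg N : (0 : ℝ) ≤ N)]
    refine (Finset.sum_le_sum h1).trans ?_
    rw [Finset.sum_add_distrib, ← Finset.mul_sum]
    refine add_le_add ?_ ?_
    · rw [← Finset.sum_filter, Finset.mul_sum]
      refine Finset.sum_le_sum_of_subset_of_nonneg (fun k hk => ?_) fun k _ _ => by positivity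
      exact (Finset.mem_filter.1 hk).2
    · rw [← div_eq_inv_mul]
      gcongr
      rw [le_div_iff₀ hpi]
      linarith [sum_norm_coeff_sq_le hf' S]
  have h3 := mul_le_mul_of_nonneg_left key hpi.le
  have e1 : 2 * Real.pi * ((N : ℝ) ^ 2 * ((2 * Real.pi)⁻¹ * normSq f)) = (N : ℝ) ^ 2 * normSq f := by
    field_simp
  have e2 : 2 * Real.pi * ((N : ℝ) ^ 2 * ∑ k ∈ F N, ‖coeff f k‖ ^ 2
      + 4 * ((2 * Real.pi)⁻¹ * normSq f'))
      = (N : ℝ) ^ 2 * (2 * Real.pi * ∑ k ∈ F N, ‖coeff f k‖ ^ 2) + 4 * normSq f' := by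
    field_simp
  rw [e1, e2] at h3
  linarith

/-- Bernstein's inequality between the sup norm and the `L²` norm of a trigonometric sum. -/
lemma norm_trigSum_sq_le (N : ℕ) (a : ℤ → ℂ) (x : ℝ) :
    ‖trigSum (F N) a x‖ ^ 2 ≤ N * normSq (trigSum (F N) a) := by
  have h1 : ‖trigSum (F N) a x‖ ≤ ∑ k ∈ F N, ‖a k‖ := by
    refine (norm_sum_le _ _).trans_eq (Finset.sum_congr rfl fun k _ => ?_)
    rw [norm_mul, norm_expo, mul_one]
  have h2 := sq_sum_le_card_mul_sum_sq (s := F N) (f := fun k => ‖a k‖)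
  rw [card_F] at h2
  have h3 : ∑ k ∈ F N, ‖a k‖ ^ 2 ≤ normSq (trigSum (F N) a) := by
    rw [normSq_trigSum]
    have : 0 ≤ ∑ k ∈ F N, ‖a k‖ ^ 2 := Finset.sum_nonneg fun _ _ => by positivity
    nlinarith [Real.pi_gt_three]
  calc _ ≤ (∑ k ∈ F N, ‖a k‖) ^ 2 := by gcongr
    _ ≤ _ := h2
    _ ≤ _ := by gcongr

@[simp] lemma proj_coe (N : ℕ) (f : ℝ → ℂ) : proj (N : ℕ∞) f = trigSum (F N) (coeff f) := rfl

@[simp] lemma proj_top (f : ℝ → ℂ) : proj ⊤ f = f := rfl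

lemma continuous_proj (M : ℕ∞) {f : ℝ → ℂ} (hf : Continuous f) : Continuous (proj M f) := by
  induction M using ENat.recTopCoe with
  | top => exact hf
  | coe m => exact continuous_trigSum (F m) (coeff f)

lemma continuous_compl (N : ℕ) (M : ℕ∞) {f : ℝ → ℂ} (hf : Continuous f) :
    Continuous (compl N M f) :=
  (continuous_proj M hf).sub (continuous_proj _ hf)

lemma coeff_proj {N : ℕ} {M : ℕ∞} (hM : (N : ℕ∞) ≤ M) (f : ℝ → ℂ) {k : ℤ} (hk : k ∈ F N) :
    coeff (proj M f) k = coeff f k := by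
  induction M using ENat.recTopCoe with
  | top => rfl
  | coe m => rw [proj_coe, coeff_trigSum, if_pos (F_subset_F (by exact_mod_cast hM) hk)]

lemma trigSum_sub (S : Finset ℤ) (a b : ℤ → ℂ) (x : ℝ) :
    trigSum S a x - trigSum S b x = trigSum S (fun k => a k - b k) x := by
  unfold trigSum
  rw [← Finset.sum_sub_distrib]
  simp_rw [sub_mul]

lemma proj_sub (M : ℕ∞) {f g : ℝ → ℂ} (hf : Continuous f) (hg : Continuous g) (x : ℝ) :
    proj M (fun y => f y - g y) x = proj M f x - proj M g x := by
  induction M using ENat.recTopCoe with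
  | top => rfl
  | coe m =>
    simp only [proj_coe, trigSum_sub]
    congr 1
    exact funext (coeff_sub hf hg)

lemma compl_sub (N : ℕ) (M : ℕ∞) {f g : ℝ → ℂ} (hf : Continuous f) (hg : Continuous g) (x : ℝ) :
    compl N M (fun y => f y - g y) x = compl N M f x - compl N M g x := by
  unfold compl
  rw [proj_sub M hf hg, proj_sub N hf hg]
  ring

lemma compl_coe {N m : ℕ} (h : N ≤ m) (f : ℝ → ℂ) :
    compl N m f = trigSum (F m \ F N) (coeff f) := by
  funext x
  unfold compl
  rw [proj_coe, proj_coe, sub_eq_iff_eq_add]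
  unfold trigSum
  exact (Finset.sum_sdiff (F_subset_F h)).symm

/-- `⟨Qf, f⟩ = ‖Qf‖₂²`, since `Q = P_M - P_N` is an orthogonal projection. -/
lemma integral_compl_mul_star {N : ℕ} {M : ℕ∞} (hM : (N : ℕ∞) ≤ M) {f : ℝ → ℂ}
    (hf : Continuous f) :
    ∫ x in (0 : ℝ)..(2 * Real.pi), compl N M f x * star (f x) = normSq (compl N M f) := by
  induction M using ENat.recTopCoe with
  | top =>
    have hT := continuous_trigSum (F N) (coeff f)
    have hc : Continuous (compl N ⊤ f) := continuous_compl N ⊤ hf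
    have h0 : ∫ x in (0 : ℝ)..(2 * Real.pi), compl N ⊤ f x
        * star (trigSum (F N) (coeff f) x) = 0 := by
      rw [integral_mul_star_trigSum hc, Finset.sum_eq_zero, mul_zero]
      intro k hk
      rw [show compl N ⊤ f = fun x => f x - trigSum (F N) (coeff f) x from rfl,
        coeff_sub hf hT, coeff_trigSum, if_pos hk, sub_self, zero_mul]
    rw [normSq_eq_integral, ← sub_eq_zero, ← intervalIntegral.integral_sub, ← h0]
    · refine intervalIntegral.integral_congr fun x _ => ?_
      simp only [compl, proj_top, proj_coe, star_sub]
      ring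
    · exact (hc.mul hf.star).intervalIntegrable _ _
    · exact (hc.mul hc.star).intervalIntegrable _ _
  | coe m =>
    rw [compl_coe (by exact_mod_cast hM)]
    have h := integral_mul_star_trigSum hf (F m \ F N) (coeff f)
    have h3 : ∀ x, trigSum (F m \ F N) (coeff f) x * star (f x)
        = (starRingEnd ℂ) (f x * star (trigSum (F m \ F N) (coeff f) x)) := fun x => by
      simp [mul_comm]
    simp_rw [h3]
    rw [intervalIntegral.intervalIntegral_conj, h, normSq_trigSum]
    simp_rw [mul_star_self]
    rw [← Complex.ofReal_sum, ← Complex.ofReal_ofNat, ← Complex.ofReal_mul,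
      ← Complex.ofReal_mul, Complex.conj_ofReal]

lemma normSq_compl_le_sub {N : ℕ} {M : ℕ∞} (hM : (N : ℕ∞) ≤ M) {f : ℝ → ℂ}
    (hf : Continuous f) :
    normSq (compl N M f) ≤ normSq (fun x => f x - trigSum (F N) (coeff f) x) := by
  induction M using ENat.recTopCoe with
  | top => exact le_rfl
  | coe m =>
    have h : N ≤ m := by exact_mod_cast hM
    rw [compl_coe h, normSq_trigSum, normSq_sub_trigSum_coeff hf]
    have h1 := sum_norm_coeff_sq_le hf (F m)
    rw [← Finset.sum_sdiff (F_subset_F h)] at h1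
    linarith

lemma normSq_compl_le {N : ℕ} {M : ℕ∞} (hM : (N : ℕ∞) ≤ M) {f : ℝ → ℂ}
    (hf : Continuous f) : normSq (compl N M f) ≤ normSq f := by
  refine (normSq_compl_le_sub hM hf).trans ?_
  rw [normSq_sub_trigSum_coeff hf]
  have : 0 ≤ ∑ k ∈ F N, ‖coeff f k‖ ^ 2 := Finset.sum_nonneg fun _ _ => by positivity
  nlinarith [Real.pi_pos]


/-! ### The quintic nonlinearity -/

lemma continuous_B {z₁ z₂ z₃ z₄ z₅ : ℝ → ℂ} (h₁ : Continuous z₁) (h₂ : Continuous z₂)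
    (h₃ : Continuous z₃) (h₄ : Continuous z₄) (h₅ : Continuous z₅) :
    Continuous (B z₁ z₂ z₃ z₄ z₅) :=
  (((h₁.mul h₂.star).mul h₃).mul h₄.star).mul h₅

lemma continuous_Bdiag {z : ℝ → ℂ} (h : Continuous z) : Continuous (Bdiag z) :=
  continuous_B h h h h h

lemma norm_Bdiag (z : ℝ → ℂ) (x : ℝ) : ‖Bdiag z x‖ = ‖z x‖ ^ 5 := by
  simp only [Bdiag, B, norm_mul, norm_star]; ring

lemma Bdiag_eq (z : ℝ → ℂ) (x : ℝ) : Bdiag z x = (‖z x‖ : ℂ) ^ 4 * z x := by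
  have h := mul_star_self (z x)
  push_cast at h
  unfold Bdiag B
  linear_combination ((z x * star (z x)) + (‖z x‖ : ℂ) ^ 2) * z x * h

lemma norm_mul_sub_mul_le {a b a' b' : ℂ} {P R p r : ℝ} (ha : ‖a - a'‖ ≤ p) (hb : ‖b - b'‖ ≤ r)
    (hb' : ‖b‖ ≤ R) (ha' : ‖a'‖ ≤ P) : ‖a * b - a' * b'‖ ≤ p * R + P * r := by
  have : a * b - a' * b' = (a - a') * b + a' * (b - b') := by ring
  rw [this]
  refine (norm_add_le _ _).trans ?_
  rw [norm_mul, norm_mul]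
  exact add_le_add (mul_le_mul ha hb' (norm_nonneg _) ((norm_nonneg _).trans ha))
    (mul_le_mul ha' hb (norm_nonneg _) ((norm_nonneg _).trans ha'))

lemma norm_Bdiag_sub_le {v w : ℝ → ℂ} {K : ℝ} (x : ℝ) (hv : ‖v x‖ ≤ K) (hw : ‖w x‖ ≤ K) :
    ‖Bdiag v x - Bdiag w x‖ ≤ 5 * K ^ 4 * ‖v x - w x‖ := by
  have hK : 0 ≤ K := (norm_nonneg _).trans hv
  have hs : ‖star (v x) - star (w x)‖ ≤ ‖v x - w x‖ := by rw [← star_sub, norm_star]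
  have hv' : ‖star (v x)‖ ≤ K := by rwa [norm_star]
  have hw' : ‖star (w x)‖ ≤ K := by rwa [norm_star]
  have b2 : ‖w x * star (w x)‖ ≤ K * K := by
    rw [norm_mul]; exact mul_le_mul hw hw' (norm_nonneg _) hK
  have b3 : ‖w x * star (w x) * w x‖ ≤ K * K * K := by
    rw [norm_mul]; exact mul_le_mul b2 hw (norm_nonneg _) (by positivity)
  have b4 : ‖w x * star (w x) * w x * star (w x)‖ ≤ K * K * K * K := by
    rw [norm_mul]; exact mul_le_mul b3 hw' (norm_nonneg _) (by positivity)
  have h2 := norm_mul_sub_mul_le (le_refl ‖v x - w x‖) hs hv' hw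
  have h3 := norm_mul_sub_mul_le h2 (le_refl ‖v x - w x‖) hv b2
  have h4 := norm_mul_sub_mul_le h3 hs hv' b3
  have h5 := norm_mul_sub_mul_le h4 (le_refl ‖v x - w x‖) hv b4
  unfold Bdiag B
  refine h5.trans_eq ?_
  ring

lemma hasDerivAt_Bdiag {w w' : ℝ → ℂ} (h : ∀ x, HasDerivAt w (w' x) x) (x : ℝ) :
    HasDerivAt (Bdiag w) (B w' w w w w x + B w w' w w w x + B w w w' w w x
      + B w w w w' w x + B w w w w w' x) x := by
  have := ((((h x).mul (h x).star).mul (h x)).mul (h x).star).mul (h x)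
  convert! this using 1
  simp only [B, Pi.mul_apply]
  ring

/-! ### Nonlinear part of the `t`-model -/

/-- The nonlinear part `i B[v,v,v,v,v] + 3it B[Γ,v,v,v,v] + 2it B[v,Γ,v,v,v]` of the `t`-model,
before projection. -/
noncomputable def force (N : ℕ) (M : ℕ∞) (t : ℝ) (v : ℝ → ℂ) (x : ℝ) : ℂ :=
  Complex.I * Bdiag v x + (t : ℂ) * (3 * Complex.I * B (Gam N M v) v v v v x
    + 2 * Complex.I * B v (Gam N M v) v v v x)

lemma continuous_Gam (N : ℕ) (M : ℕ∞) {v : ℝ → ℂ} (hv : Continuous v) :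
    Continuous (Gam N M v) :=
  continuous_const.mul (continuous_compl N M (continuous_Bdiag hv))

lemma norm_Gam (N : ℕ) (M : ℕ∞) (v : ℝ → ℂ) (x : ℝ) :
    ‖Gam N M v x‖ = ‖compl N M (Bdiag v) x‖ := by
  simp [Gam]

lemma normSq_Gam (N : ℕ) (M : ℕ∞) (v : ℝ → ℂ) :
    normSq (compl N M (Bdiag v)) = normSq (Gam N M v) := by
  simp only [normSq, norm_Gam]

lemma continuous_force (N : ℕ) (M : ℕ∞) (t : ℝ) {v : ℝ → ℂ} (hv : Continuous v) :
    Continuous (force N M t v) := by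
  have hG := continuous_Gam N M hv
  have h1 := continuous_Bdiag hv
  have h2 := continuous_B hG hv hv hv hv
  have h3 := continuous_B hv hG hv hv hv
  unfold force
  fun_prop

lemma coeff_force (N : ℕ) (M : ℕ∞) (t : ℝ) {v : ℝ → ℂ} (hv : Continuous v) (k : ℤ) :
    coeff (force N M t v) k = Complex.I * coeff (Bdiag v) k
      + (t : ℂ) * (3 * Complex.I * coeff (B (Gam N M v) v v v v) k
        + 2 * Complex.I * coeff (B v (Gam N M v) v v v) k) := by
  have hG := continuous_Gam N M hv
  have h1 := continuous_Bdiag hv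
  have h2 := continuous_B hG hv hv hv hv
  have h3 := continuous_B hv hG hv hv hv
  unfold force
  rw [coeff_add (by fun_prop) (by fun_prop), coeff_const_mul, coeff_const_mul,
    coeff_add (by fun_prop) (by fun_prop), coeff_const_mul, coeff_const_mul]

/-- The dispersive term is skew-adjoint, so the rate of change of the energy of a trigonometric
sum evolving under `b' = i b_xx + P g` is the pairing with `g`. -/
lemma hasDerivWithinAt_half_normSq {S : Finset ℤ} {b : ℝ → ℤ → ℂ} {g : ℝ → ℂ} {s : Set ℝ} {t : ℝ}
    (hg : Continuous g)
    (h : ∀ k ∈ S, HasDerivWithinAt (fun r => b r k)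
      (-Complex.I * (k : ℂ) ^ 2 * b t k + coeff g k) s t) :
    HasDerivWithinAt (fun r => 1 / 2 * normSq (trigSum S (b r)))
      (∫ x in (0 : ℝ)..(2 * Real.pi), (g x * star (trigSum S (b t) x)).re) s t := by
  simp_rw [normSq_trigSum]
  have hd := ((HasDerivWithinAt.fun_sum fun k hk => (h k hk).norm_sq).const_mul
    (2 * Real.pi)).const_mul (1 / 2 : ℝ)
  refine hd.congr_deriv ?_
  have hc : Continuous fun x => g x * star (trigSum S (b t) x) :=
    hg.mul (continuous_trigSum S (b t)).star
  rw [← integral_re hc, integral_mul_star_trigSum hg]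
  have : (2 * Real.pi : ℂ) = ((2 * Real.pi : ℝ) : ℂ) := by push_cast; rfl
  rw [this, Complex.re_ofReal_mul, Complex.re_sum, ← Finset.mul_sum]
  have hk : ∀ k ∈ S, inner ℝ (b t k) (-Complex.I * (k : ℂ) ^ 2 * b t k + coeff g k)
      = (coeff g k * star (b t k)).re := by
    intro k _
    obtain ⟨r, hr⟩ : ∃ r : ℝ, (k : ℂ) ^ 2 = r := ⟨(k : ℝ) ^ 2, by push_cast; rfl⟩
    rw [hr]
    simp [Complex.inner]
    ring
  rw [Finset.sum_congr rfl hk]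
  ring

lemma continuous_resolved (N : ℕ) (a : ℝ → ℤ → ℂ) (t : ℝ) : Continuous (resolved N a t) :=
  continuous_trigSum _ _

lemma IsTModel.hasDerivWithinAt {N : ℕ} {M : ℕ∞} {T : ℝ} {a : ℝ → ℤ → ℂ}
    (ha : IsTModel N M T a) {t : ℝ} (ht : t ∈ Icc 0 T) {k : ℤ} (hk : k ∈ F N) :
    HasDerivWithinAt (fun s => a s k) (-Complex.I * (k : ℂ) ^ 2 * a t k
      + coeff (force N M t (resolved N a t)) k) (Icc 0 T) t := by
  rw [coeff_force N M t (continuous_resolved N a t)]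
  have := ha t ht _ _ rfl rfl k hk
  rwa [add_assoc] at this

/-- The energy of the `t`-model decays at the rate `t‖Γ‖₂²`: only the memory term contributes, and
`Re ⟨Df(v)Γ, v⟩ = -Im ⟨Γ, |v|⁴v⟩ = -‖Γ‖₂²`, where `f(v) = i|v|⁴v`. -/
lemma IsTModel.energy {N : ℕ} {M : ℕ∞} {T : ℝ} {a : ℝ → ℤ → ℂ} (hM : (N : ℕ∞) ≤ M)
    (ha : IsTModel N M T a) {t : ℝ} (ht : t ∈ Icc 0 T) :
    HasDerivWithinAt (fun s => 1 / 2 * normSq (resolved N a s))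
      (-t * normSq (compl N M (Bdiag (resolved N a t)))) (Icc 0 T) t := by
  have hv := continuous_resolved N a t
  have h := hasDerivWithinAt_half_normSq (S := F N) (b := a) (continuous_force N M t hv)
    (fun k hk => ha.hasDerivWithinAt ht hk)
  refine h.congr_deriv ?_
  change ∫ x in (0 : ℝ)..(2 * Real.pi),
    (force N M t (resolved N a t) x * star (resolved N a t x)).re = _
  set v := resolved N a t
  have hp : ∀ x, (force N M t v x * star (v x)).re
      = -t * (compl N M (Bdiag v) x * star (Bdiag v x)).re := by
    intro x
    unfold force Gam
    rw [show ∀ z : ℝ → ℂ, B z v v v v x = z x * star (v x) * v x * star (v x) * v x from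
      fun _ => rfl, show ∀ z : ℝ → ℂ, B v z v v v x = v x * star (z x) * v x * star (v x) * v x
      from fun _ => rfl]
    simp only [Bdiag_eq]
    generalize compl N M (Bdiag v) x = c
    have h1 : star (v x) * v x = ((‖v x‖ ^ 2 : ℝ) : ℂ) := by rw [mul_comm, mul_star_self]
    have e1 : (Complex.I * ((‖v x‖ : ℂ) ^ 4 * v x) + (t : ℂ) * (3 * Complex.I *
        (Complex.I * c * star (v x) * v x * star (v x) * v x) + 2 * Complex.I *
        (v x * star (Complex.I * c) * v x * star (v x) * v x))) * star (v x)
        = ((‖v x‖ ^ 6 : ℝ) : ℂ) * Complex.I + (t : ℂ) * (((‖v x‖ ^ 4 : ℝ) : ℂ) *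
          (-3 * (c * star (v x)) + 2 * (star c * v x))) := by
      have h2 := h1
      push_cast at h2 ⊢
      have hI : star Complex.I = - Complex.I := Complex.conj_I
      rw [star_mul', hI]
      have hII := Complex.I_mul_I
      linear_combination (Complex.I * (‖v x‖ : ℂ) ^ 4 + (t : ℂ) * (
        -3 * c * star (v x) + 2 * star c * v x) * (star (v x) * v x + (‖v x‖ : ℂ) ^ 2)) * h2 +
        (t : ℂ) * (star (v x) * v x) ^ 2 * (3 * c * star (v x) - 2 * star c * v x) * hII
    rw [e1]
    have e2 : (star c * v x).re = (c * star (v x)).re := by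
      simp [Complex.mul_re]
    have e3 : c * star ((‖v x‖ : ℂ) ^ 4 * v x) = ((‖v x‖ ^ 4 : ℝ) : ℂ) * (c * star (v x)) := by
      rw [star_mul', ← Complex.ofReal_pow, Complex.star_def, Complex.conj_ofReal]; ring
    rw [e3, Complex.add_re, Complex.re_ofReal_mul, Complex.re_ofReal_mul, Complex.re_ofReal_mul,
      Complex.re_ofReal_mul, Complex.add_re, Complex.I_re,
      show (-3 : ℂ) = ((-3 : ℝ) : ℂ) by push_cast; rfl,
      show (2 : ℂ) = ((2 : ℝ) : ℂ) by push_cast; rfl,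
      Complex.re_ofReal_mul, Complex.re_ofReal_mul, e2]
    ring
  simp_rw [hp]
  have hB := continuous_Bdiag hv
  have hc : Continuous fun x => compl N M (Bdiag v) x * star (Bdiag v x) :=
    (continuous_compl N M hB).mul hB.star
  rw [intervalIntegral.integral_const_mul, ← integral_re hc, integral_compl_mul_star hM hB,
    Complex.ofReal_re]


/-! ### Smooth solutions of the full system -/

/-- Differentiation of a Fourier coefficient in time, for a time derivative that is bounded but
not assumed jointly continuous: dominated convergence for the difference quotients. -/
lemma hasDerivWithinAt_coeff {u g : ℝ → ℝ → ℂ} {T C : ℝ} (hu : ∀ s ∈ Icc 0 T, Continuous (u s))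
    (hd : ∀ s ∈ Icc 0 T, ∀ x, HasDerivWithinAt (fun r => u r x) (g s x) (Icc 0 T) s)
    (hb : ∀ s ∈ Icc 0 T, ∀ x, ‖g s x‖ ≤ C) {t : ℝ} (ht : t ∈ Icc 0 T) (k : ℤ) :
    HasDerivWithinAt (fun s => coeff (u s) k) (coeff (g t) k) (Icc 0 T) t := by
  unfold coeff
  refine HasDerivWithinAt.const_mul _ ?_
  rw [hasDerivWithinAt_iff_tendsto_slope]
  have hmem : ∀ᶠ s in 𝓝[Icc 0 T \ {t}] t, s ∈ Icc 0 T \ {t} := self_mem_nhdsWithin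
  have hs : (fun s => ∫ x in (0 : ℝ)..(2 * Real.pi), slope (fun r => u r x) t s * expo (-k) x)
      =ᶠ[𝓝[Icc 0 T \ {t}] t]
      slope (fun s => ∫ x in (0 : ℝ)..(2 * Real.pi), u s x * expo (-k) x) t := by
    filter_upwards [hmem] with s hs
    simp only [slope, vsub_eq_sub]
    rw [← intervalIntegral.integral_sub (f := fun x => u s x * expo (-k) x)
      (g := fun x => u t x * expo (-k) x) (((hu s hs.1).mul (continuous_expo _)).intervalIntegrable _ _)
      (((hu t ht).mul (continuous_expo _)).intervalIntegrable _ _),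
      ← intervalIntegral.integral_smul]
    refine intervalIntegral.integral_congr fun x _ => ?_
    simp only [Complex.real_smul]
    ring
  refine Tendsto.congr' hs ?_
  refine intervalIntegral.tendsto_integral_filter_of_dominated_convergence (fun _ => C) ?_ ?_ ?_ ?_
  · filter_upwards [hmem] with s hs
    have : Continuous fun x => slope (fun r => u r x) t s * expo (-k) x := by
      simp only [slope, vsub_eq_sub]
      exact (continuous_const.smul ((hu s hs.1).sub (hu t ht))).mul (continuous_expo _)
    exact this.aestronglyMeasurable
  · filter_upwards [hmem] with s hs
    refine Eventually.of_forall fun x _ => ?_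
    rw [norm_mul, norm_expo, mul_one, slope, norm_smul, vsub_eq_sub, norm_inv]
    have h0 : 0 < ‖s - t‖ := norm_pos_iff.2 (sub_ne_zero.2 hs.2)
    rw [inv_mul_le_iff₀ h0, mul_comm]
    exact (convex_Icc 0 T).norm_image_sub_le_of_norm_hasDerivWithin_le
      (fun r hr => hd r hr x) (fun r hr => hb r hr x) ht hs.1
  · exact _root_.intervalIntegrable_const
  · refine Eventually.of_forall fun x _ => ?_
    exact (hasDerivWithinAt_iff_tendsto_slope.1 (hd t ht x)).mul_const _

lemma norm_proj_coe_le {N : ℕ} {f : ℝ → ℂ} {K : ℝ} (h : ∀ x, ‖f x‖ ≤ K) (x : ℝ) :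
    ‖trigSum (F N) (coeff f) x‖ ≤ N * K := by
  refine (norm_sum_le _ _).trans ?_
  refine (Finset.sum_le_card_nsmul (F N) _ K fun k _ => ?_).trans_eq ?_
  · rw [norm_mul, norm_expo, mul_one]; exact norm_coeff_le h k
  · rw [card_F, nsmul_eq_mul]

lemma exists_norm_proj_le (M : ℕ∞) (K : ℝ) :
    ∃ C, ∀ f : ℝ → ℂ, (∀ x, ‖f x‖ ≤ K) → ∀ x, ‖proj M f x‖ ≤ C := by
  induction M using ENat.recTopCoe with
  | top => exact ⟨K, fun f h => h⟩
  | coe m => exact ⟨m * K, fun f h => norm_proj_coe_le h⟩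

lemma deriv_periodic {f : ℝ → ℂ} {c : ℝ} (h : Function.Periodic f c) :
    Function.Periodic (deriv f) c := by
  intro x
  rw [← deriv_comp_add_const]
  congr 1
  exact funext h

namespace IsFullSolution

variable {M : ℕ∞} {T : ℝ} {u : ℝ → ℝ → ℂ} {t : ℝ}

lemma contDiff (hu : IsFullSolution M T u) (ht : t ∈ Icc 0 T) : ContDiff ℝ ∞ (u t) :=
  hu.smooth.comp_contDiff (f := fun x : ℝ => (t, x)) (by fun_prop) fun _ => ⟨ht, mem_univ _⟩

lemma continuous (hu : IsFullSolution M T u) (ht : t ∈ Icc 0 T) : Continuous (u t) :=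
  (hu.contDiff ht).continuous

lemma hasDerivAt (hu : IsFullSolution M T u) (ht : t ∈ Icc 0 T) (x : ℝ) :
    HasDerivAt (u t) (deriv (u t) x) x :=
  ((hu.contDiff ht).differentiable (by simp) x).hasDerivAt

lemma contDiff_deriv (hu : IsFullSolution M T u) (ht : t ∈ Icc 0 T) :
    ContDiff ℝ ∞ (deriv (u t)) :=
  (contDiff_infty_iff_deriv.1 (hu.contDiff ht)).2

lemma hasDerivAt_deriv (hu : IsFullSolution M T u) (ht : t ∈ Icc 0 T) (x : ℝ) :
    HasDerivAt (deriv (u t)) (iteratedDeriv 2 (u t) x) x := by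
  rw [iteratedDeriv_succ, iteratedDeriv_one]
  exact ((hu.contDiff_deriv ht).differentiable (by simp) x).hasDerivAt

lemma continuous_iteratedDeriv_two (hu : IsFullSolution M T u) (ht : t ∈ Icc 0 T) :
    Continuous (iteratedDeriv 2 (u t)) := by
  rw [iteratedDeriv_succ, iteratedDeriv_one]
  exact (contDiff_infty_iff_deriv.1 (hu.contDiff_deriv ht)).2.continuous

lemma two_pi_eq (hu : IsFullSolution M T u) (ht : t ∈ Icc 0 T) : u t (2 * Real.pi) = u t 0 := by
  have := hu.periodic t ht 0
  rwa [zero_add] at this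

lemma coeff_deriv_eq (hu : IsFullSolution M T u) (ht : t ∈ Icc 0 T) (k : ℤ) :
    coeff (deriv (u t)) k = Complex.I * k * coeff (u t) k :=
  coeff_deriv (hu.hasDerivAt ht) (hu.contDiff_deriv ht).continuous (hu.two_pi_eq ht) k

lemma coeff_iteratedDeriv_two (hu : IsFullSolution M T u) (ht : t ∈ Icc 0 T) (k : ℤ) :
    coeff (iteratedDeriv 2 (u t)) k = -(k : ℂ) ^ 2 * coeff (u t) k := by
  have hp : deriv (u t) (2 * Real.pi) = deriv (u t) 0 := by
    have := deriv_periodic (hu.periodic t ht) 0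
    rwa [zero_add] at this
  rw [coeff_deriv (hu.hasDerivAt_deriv ht) (hu.continuous_iteratedDeriv_two ht) hp,
    hu.coeff_deriv_eq ht]
  linear_combination (k : ℂ) ^ 2 * coeff (u t) k * Complex.I_mul_I

lemma hasDerivWithinAt_time (hu : IsFullSolution M T u) (ht : t ∈ Icc 0 T) (x : ℝ) :
    HasDerivWithinAt (fun s => u s x)
      (Complex.I * iteratedDeriv 2 (u t) x + Complex.I * proj M (Bdiag (u t)) x) (Icc 0 T) t := by
  have hd : DifferentiableOn ℝ (fun s => u s x) (Icc 0 T) :=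
    (hu.smooth.comp (f := fun s : ℝ => (s, x)) (by fun_prop)
      fun s hs => ⟨hs, mem_univ _⟩).differentiableOn (by simp)
  refine (hd t ht).hasDerivWithinAt.congr_deriv ?_
  have h := hu.equation t ht x
  rw [show (fun y => (‖u t y‖ : ℂ) ^ 4 * u t y) = Bdiag (u t) from
    funext fun y => (Bdiag_eq _ y).symm] at h
  linear_combination -Complex.I * h + derivWithin (fun s => u s x) (Icc 0 T) t * Complex.I_mul_I

/-- The resolved modes of the full system satisfy `∂ₜ û_k = -i k² û_k + i (|u|⁴u)^_k`. -/
lemma hasDerivWithinAt_coeff {N : ℕ} (hM : (N : ℕ∞) ≤ M) (hu : IsFullSolution M T u) {K₀ K₂ : ℝ}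
    (h₀ : ∀ t ∈ Icc 0 T, ∀ x, ‖u t x‖ ≤ K₀)
    (h₂ : ∀ t ∈ Icc 0 T, ∀ x, ‖iteratedDeriv 2 (u t) x‖ ≤ K₂)
    (ht : t ∈ Icc 0 T) {k : ℤ} (hk : k ∈ F N) :
    HasDerivWithinAt (fun s => coeff (u s) k)
      (-Complex.I * (k : ℂ) ^ 2 * coeff (u t) k + coeff (fun x => Complex.I * Bdiag (u t) x) k)
      (Icc 0 T) t := by
  obtain ⟨C, hC⟩ := exists_norm_proj_le M (K₀ ^ 5)
  have hb : ∀ s ∈ Icc 0 T, ∀ x, ‖Complex.I * iteratedDeriv 2 (u s) x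
      + Complex.I * proj M (Bdiag (u s)) x‖ ≤ K₂ + C := by
    intro s hs x
    refine (norm_add_le _ _).trans ?_
    rw [norm_mul, norm_mul, Complex.norm_I, one_mul, one_mul]
    refine add_le_add (h₂ s hs x) (hC _ (fun y => ?_) x)
    rw [norm_Bdiag]
    exact pow_le_pow_left₀ (norm_nonneg _) (h₀ s hs y) 5
  have h := NLS.hasDerivWithinAt_coeff (fun s hs => hu.continuous hs)
    (fun s hs x => hu.hasDerivWithinAt_time hs x) hb ht k
  refine h.congr_deriv ?_
  have hP := continuous_proj M (continuous_Bdiag (hu.continuous ht))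
  have h2 := hu.continuous_iteratedDeriv_two ht
  rw [coeff_add (by fun_prop) (by fun_prop), coeff_const_mul, coeff_const_mul, coeff_const_mul,
    coeff_proj hM _ hk, hu.coeff_iteratedDeriv_two ht]
  ring

/-- Two derivatives make the Fourier series absolutely summable, so the projections of `u` are
bounded uniformly in the number of modes. -/
lemma norm_proj_le (hu : IsFullSolution M T u) (ht : t ∈ Icc 0 T) {K₀ K₂ : ℝ}
    (h₀ : ∀ x, ‖u t x‖ ≤ K₀) (h₂ : ∀ x, ‖iteratedDeriv 2 (u t) x‖ ≤ K₂) (N : ℕ) (x : ℝ) :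
    ‖proj N (u t) x‖ ≤ K₀ + K₂ * ∑' k : ℤ, 1 / (k : ℝ) ^ 2 := by
  have hK₀ := (norm_nonneg _).trans (h₀ 0)
  have hK₂ := (norm_nonneg _).trans (h₂ 0)
  have hk : ∀ k : ℤ, ‖coeff (u t) k‖ ≤ (if k = 0 then K₀ else 0) + K₂ * (1 / (k : ℝ) ^ 2) := by
    intro k
    split_ifs with h
    · have := norm_coeff_le h₀ k
      have : 0 ≤ K₂ * (1 / (k : ℝ) ^ 2) := by positivity
      linarith
    · have h1 := norm_coeff_le h₂ k
      rw [hu.coeff_iteratedDeriv_two ht, norm_mul, norm_neg, norm_pow, Complex.norm_intCast,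
        sq_abs] at h1
      have h2 : 0 < (k : ℝ) ^ 2 := by positivity
      rw [zero_add, mul_one_div, le_div_iff₀ h2]
      linarith
  have hs : Summable fun k : ℤ => 1 / (k : ℝ) ^ 2 :=
    Real.summable_one_div_int_pow.2 one_lt_two
  calc ‖proj N (u t) x‖ ≤ ∑ k ∈ F N, ‖coeff (u t) k‖ := by
        rw [proj_coe]
        refine (norm_sum_le _ _).trans_eq (Finset.sum_congr rfl fun k _ => ?_)
        rw [norm_mul, norm_expo, mul_one]
    _ ≤ ∑ k ∈ F N, ((if k = 0 then K₀ else 0) + K₂ * (1 / (k : ℝ) ^ 2)) :=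
        Finset.sum_le_sum fun k _ => hk k
    _ ≤ _ := by
      rw [Finset.sum_add_distrib, ← Finset.mul_sum, Finset.sum_ite_eq']
      refine add_le_add ?_ (mul_le_mul_of_nonneg_left ?_ hK₂)
      · split_ifs <;> simp [hK₀]
      · exact hs.sum_le_tsum _ fun k _ => by positivity

lemma hasDerivAt_proj (hu : IsFullSolution M T u) (ht : t ∈ Icc 0 T) (N : ℕ) (x : ℝ) :
    HasDerivAt (proj N (u t)) (proj N (deriv (u t)) x) x := by
  have h : HasDerivAt (fun y => ∑ k ∈ F N, coeff (u t) k * expo k y)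
      (∑ k ∈ F N, coeff (u t) k * (Complex.I * k * expo k x)) x :=
    HasDerivAt.fun_sum fun k _ => (hasDerivAt_expo k x).const_mul _
  refine h.congr_deriv (Finset.sum_congr rfl fun k _ => ?_)
  rw [hu.coeff_deriv_eq ht]
  ring

/-- The unresolved part of the solution is `O(1/N)` in `L²`. -/
lemma sq_mul_normSq_compl_le {N : ℕ} (hM : (N : ℕ∞) ≤ M) (hu : IsFullSolution M T u)
    (ht : t ∈ Icc 0 T) :
    (N : ℝ) ^ 2 * normSq (compl N M (u t)) ≤ 4 * normSq (deriv (u t)) :=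
  (mul_le_mul_of_nonneg_left (normSq_compl_le_sub hM (hu.continuous ht)) (by positivity)).trans
    (normSq_sub_trigSum_F_le (hu.hasDerivAt ht) (hu.contDiff_deriv ht).continuous
      (hu.two_pi_eq ht) N)

/-- The unresolved part of the nonlinearity at the resolved part of the solution is `O(1/N)` in
`L²`. -/
lemma sq_mul_normSq_compl_Bdiag_le {N : ℕ} (hM : (N : ℕ∞) ≤ M) (hu : IsFullSolution M T u)
    (ht : t ∈ Icc 0 T) {K : ℝ} (hK : ∀ x, ‖proj N (u t) x‖ ≤ K) :
    (N : ℝ) ^ 2 * normSq (compl N M (Bdiag (proj N (u t))))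
      ≤ 100 * K ^ 8 * normSq (deriv (u t)) := by
  set w := proj N (u t) with hw
  set w' := proj N (deriv (u t)) with hw'
  have hwc : Continuous w := continuous_proj _ (hu.continuous ht)
  have hdc : Continuous (deriv (u t)) := (hu.contDiff_deriv ht).continuous
  have hwc' : Continuous w' := continuous_proj _ hdc
  have hd := hasDerivAt_Bdiag (hu.hasDerivAt_proj ht N)
  rw [← hw, ← hw'] at hd
  have hc : Continuous fun x => B w' w w w w x + B w w' w w w x + B w w w' w w x
      + B w w w w' w x + B w w w w w' x := by
    unfold B; fun_prop
  have hp : Bdiag w (2 * Real.pi) = Bdiag w 0 := by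
    have : w (2 * Real.pi) = w 0 := by
      simp only [hw, proj_coe, trigSum, expo_two_pi, expo_at_zero]
    simp only [Bdiag, B, this]
  have h1 := normSq_sub_trigSum_F_le hd hc hp N
  have h2 : normSq (fun x => B w' w w w w x + B w w' w w w x + B w w w' w w x
      + B w w w w' w x + B w w w w w' x) ≤ (25 * K ^ 8) * normSq w' := by
    refine normSq_mono hc hwc' fun x => ?_
    have hwK := hK x
    have h3 : ‖B w' w w w w x + B w w' w w w x + B w w w' w w x
      + B w w w w' w x + B w w w w w' x‖ ≤ 5 * ‖w x‖ ^ 4 * ‖w' x‖ := by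
      refine (norm_add_le_of_le (norm_add_le_of_le (norm_add_le_of_le (norm_add_le_of_le le_rfl
        le_rfl) le_rfl) le_rfl) le_rfl).trans_eq ?_
      simp only [B, norm_mul, norm_star]
      ring
    calc _ ≤ (5 * ‖w x‖ ^ 4 * ‖w' x‖) ^ 2 := by gcongr
      _ = 25 * ‖w x‖ ^ 8 * ‖w' x‖ ^ 2 := by ring
      _ ≤ _ := by gcongr
  have h4 : normSq w' ≤ normSq (deriv (u t)) := normSq_trigSum_coeff_le hdc _
  have hB : Continuous (Bdiag w) := continuous_Bdiag hwc
  calc _ ≤ (N : ℝ) ^ 2 * normSq (fun x => Bdiag w x - trigSum (F N) (coeff (Bdiag w)) x) := by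
        gcongr; exact normSq_compl_le_sub hM hB
    _ ≤ 4 * ((25 * K ^ 8) * normSq w') := h1.trans (by gcongr)
    _ ≤ 4 * ((25 * K ^ 8) * normSq (deriv (u t))) := by gcongr
    _ = _ := by ring

end IsFullSolution


/-! ### The error estimate -/

/-- The rate of change of `½‖v - Pu‖₂²`, namely
`Re ∫ (i|v|⁴v + 3it|v|⁴Γ + 2it|v|²v²Γ* - i|u|⁴u) (v - Pu)* dx`. -/
noncomputable def errRate (N : ℕ) (M : ℕ∞) (a : ℝ → ℤ → ℂ) (u : ℝ → ℝ → ℂ) (t : ℝ) : ℝ :=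
  ∫ x in (0 : ℝ)..(2 * Real.pi), ((force N M t (resolved N a t) x - Complex.I * Bdiag (u t) x)
    * star (resolved N a t x - proj N (u t) x)).re

lemma resolved_sub_proj (N : ℕ) (a : ℝ → ℤ → ℂ) (u : ℝ → ℝ → ℂ) (t : ℝ) :
    (fun x => resolved N a t x - proj N (u t) x)
      = trigSum (F N) (fun k => a t k - coeff (u t) k) :=
  funext fun x => trigSum_sub (F N) (a t) (coeff (u t)) x

lemma hasDerivWithinAt_errSq {N : ℕ} {M : ℕ∞} {T : ℝ} {a : ℝ → ℤ → ℂ} {u : ℝ → ℝ → ℂ}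
    (hM : (N : ℕ∞) ≤ M) (ha : IsTModel N M T a) (hu : IsFullSolution M T u) {K₀ K₂ : ℝ}
    (h₀ : ∀ t ∈ Icc 0 T, ∀ x, ‖u t x‖ ≤ K₀)
    (h₂ : ∀ t ∈ Icc 0 T, ∀ x, ‖iteratedDeriv 2 (u t) x‖ ≤ K₂) {t : ℝ} (ht : t ∈ Icc 0 T) :
    HasDerivWithinAt (fun s => 1 / 2 * errSq N a u s) (errRate N M a u t) (Icc 0 T) t := by
  have hF := continuous_force N M t (continuous_resolved N a t)
  have hB : Continuous fun x => Complex.I * Bdiag (u t) x :=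
    continuous_const.mul (continuous_Bdiag (hu.continuous ht))
  have h := hasDerivWithinAt_half_normSq (S := F N) (b := fun s k => a s k - coeff (u s) k)
    (s := Icc 0 T) (t := t)
    (g := fun x => force N M t (resolved N a t) x - Complex.I * Bdiag (u t) x) (hF.sub hB)
    (fun k hk => ((ha.hasDerivWithinAt ht hk).sub
      (hu.hasDerivWithinAt_coeff hM h₀ h₂ ht hk)).congr_deriv (by
        rw [coeff_sub hF hB]; ring))
  simp only [← resolved_sub_proj] at h
  exact h

/-- The rate of change of the error is controlled by the error, the unresolved part `q = Qu` of the
solution and the unresolved part `g₁` of `|w|⁴w`, `w = Pu`. The quadratic form in `v - w` and `q`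
comes from the Lipschitz bound for `z ↦ |z|⁴z`; in the memory term `Γ = i(g₁ + g₂)` with
`‖g₂‖₂ ≤ 5K⁴‖v - w‖₂`. -/
lemma integral_force_le {N : ℕ} {M : ℕ∞} (hM : (N : ℕ∞) ≤ M) {v w u : ℝ → ℂ} {K t : ℝ}
    (ht : 0 ≤ t) (hv : Continuous v) (hw : Continuous w) (hu : Continuous u)
    (hvK : ∀ x, ‖v x‖ ≤ K) (hwK : ∀ x, ‖w x‖ ≤ K) (huK : ∀ x, ‖u x‖ ≤ K) :
    ∫ x in (0 : ℝ)..(2 * Real.pi), ((force N M t v x - Complex.I * Bdiag u x)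
      * star (v x - w x)).re
    ≤ (10 * K ^ 4 + t * (33 * K ^ 8)) * normSq (fun x => v x - w x)
      + 5 * K ^ 4 * normSq (fun x => u x - w x)
      + 1664 * t * normSq (compl N M (Bdiag w)) := by
  have hBv := continuous_Bdiag hv
  have hBw := continuous_Bdiag hw
  have hBu := continuous_Bdiag hu
  have he : Continuous fun x => v x - w x := hv.sub hw
  have hq : Continuous fun x => u x - w x := hu.sub hw
  have hg1 := continuous_compl N M hBw
  have hd : Continuous fun x => Bdiag v x - Bdiag w x := hBv.sub hBw
  have hg2 := continuous_compl N M hd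
  have hF := continuous_force N M t hv
  have hG2 : normSq (compl N M fun x => Bdiag v x - Bdiag w x)
      ≤ 25 * K ^ 8 * normSq (fun x => v x - w x) := by
    refine (normSq_compl_le hM hd).trans (normSq_mono hd he fun x => ?_)
    calc _ ≤ (5 * K ^ 4 * ‖v x - w x‖) ^ 2 := by
          gcongr; exact norm_Bdiag_sub_le x (hvK x) (hwK x)
      _ = _ := by ring
  have hpt : ∀ x, ((force N M t v x - Complex.I * Bdiag u x) * star (v x - w x)).re
      ≤ (10 * K ^ 4 + t * (8 * K ^ 8)) * ‖v x - w x‖ ^ 2 + 5 * K ^ 4 * ‖u x - w x‖ ^ 2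
        + 1664 * t * ‖compl N M (Bdiag w) x‖ ^ 2
        + t * ‖compl N M (fun x => Bdiag v x - Bdiag w x) x‖ ^ 2 := by
    intro x
    have hK : 0 ≤ K := (norm_nonneg _).trans (hvK x)
    set e := ‖v x - w x‖ with hedef
    set q := ‖u x - w x‖ with hqdef
    set g1 := ‖compl N M (Bdiag w) x‖ with hg1def
    set g2 := ‖compl N M (fun x => Bdiag v x - Bdiag w x) x‖ with hg2def
    have e0 : 0 ≤ e := norm_nonneg _
    have q0 : 0 ≤ q := norm_nonneg _
    have g10 : 0 ≤ g1 := norm_nonneg _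
    have g20 : 0 ≤ g2 := norm_nonneg _
    have hΓ : ‖Gam N M v x‖ ≤ g1 + g2 := by
      rw [norm_Gam, show compl N M (Bdiag v) x = compl N M (Bdiag w) x
        + compl N M (fun x => Bdiag v x - Bdiag w x) x by rw [compl_sub N M hBv hBw]; ring]
      exact norm_add_le _ _
    have hX : ‖3 * Complex.I * B (Gam N M v) v v v v x + 2 * Complex.I * B v (Gam N M v) v v v x‖
        ≤ 5 * K ^ 4 * (g1 + g2) := by
      refine (norm_add_le _ _).trans ?_
      have h4 : ‖v x‖ ^ 4 ≤ K ^ 4 := pow_le_pow_left₀ (norm_nonneg _) (hvK x) 4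
      calc _ = 5 * ‖v x‖ ^ 4 * ‖Gam N M v x‖ := by
            simp only [B, norm_mul, norm_star, Complex.norm_I, Complex.norm_ofNat]; ring
        _ ≤ _ := by gcongr
    have hBvu : ‖Bdiag v x - Bdiag u x‖ ≤ 5 * K ^ 4 * (e + q) := by
      refine (norm_Bdiag_sub_le x (hvK x) (huK x)).trans ?_
      gcongr
      rw [show v x - u x = (v x - w x) - (u x - w x) by ring]
      exact norm_sub_le _ _
    have hfull : ‖force N M t v x - Complex.I * Bdiag u x‖
        ≤ 5 * K ^ 4 * (e + q) + t * (5 * K ^ 4 * (g1 + g2)) := by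
      have : force N M t v x - Complex.I * Bdiag u x
          = Complex.I * (Bdiag v x - Bdiag u x) + (t : ℂ) * (3 * Complex.I
            * B (Gam N M v) v v v v x + 2 * Complex.I * B v (Gam N M v) v v v x) := by
        unfold force; ring
      rw [this]
      refine (norm_add_le _ _).trans (add_le_add ?_ ?_)
      · rwa [norm_mul, Complex.norm_I, one_mul]
      · rw [norm_mul, Complex.norm_real, Real.norm_of_nonneg ht]
        gcongr
    have h1 : ((force N M t v x - Complex.I * Bdiag u x) * star (v x - w x)).re
        ≤ (5 * K ^ 4 * (e + q) + t * (5 * K ^ 4 * (g1 + g2))) * e := by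
      refine (Complex.re_le_norm _).trans ?_
      rw [norm_mul, norm_star]
      gcongr
    -- Young's inequality, with the weight `1664` on the square of `g1`
    have y1 : K ^ 4 * ((e + q) * e) ≤ K ^ 4 * (2 * e ^ 2 + q ^ 2) := by
      gcongr; nlinarith [sq_nonneg (e - q)]
    have y2 : 5 * K ^ 4 * (g1 + g2) * e ≤ 1664 * g1 ^ 2 + g2 ^ 2 + 8 * (K ^ 4 * e) ^ 2 := by
      nlinarith [sq_nonneg (40 * g1 - K ^ 4 * e / 16), sq_nonneg (g2 - 5 / 2 * (K ^ 4 * e)),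
        sq_nonneg (K ^ 4 * e), sq_nonneg g1]
    have y3 := mul_le_mul_of_nonneg_left y2 ht
    calc _ ≤ _ := h1
      _ = 5 * (K ^ 4 * ((e + q) * e)) + t * (5 * K ^ 4 * (g1 + g2) * e) := by ring
      _ ≤ 5 * (K ^ 4 * (2 * e ^ 2 + q ^ 2))
          + t * (1664 * g1 ^ 2 + g2 ^ 2 + 8 * (K ^ 4 * e) ^ 2) := by linarith
      _ = _ := by ring
  have hint : ∫ x in (0 : ℝ)..(2 * Real.pi), ((force N M t v x - Complex.I * Bdiag u x)
      * star (v x - w x)).re ≤ (10 * K ^ 4 + t * (8 * K ^ 8)) * normSq (fun x => v x - w x)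
        + 5 * K ^ 4 * normSq (fun x => u x - w x) + 1664 * t * normSq (compl N M (Bdiag w))
        + t * normSq (compl N M fun x => Bdiag v x - Bdiag w x) := by
    have i1 : IntervalIntegrable (fun x => (10 * K ^ 4 + t * (8 * K ^ 8)) * ‖v x - w x‖ ^ 2)
        volume 0 (2 * Real.pi) := (continuous_const.mul (he.norm.pow 2)).intervalIntegrable _ _
    have i2 : IntervalIntegrable (fun x => 5 * K ^ 4 * ‖u x - w x‖ ^ 2)
        volume 0 (2 * Real.pi) := (continuous_const.mul (hq.norm.pow 2)).intervalIntegrable _ _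
    have i3 : IntervalIntegrable (fun x => 1664 * t * ‖compl N M (Bdiag w) x‖ ^ 2)
        volume 0 (2 * Real.pi) := (continuous_const.mul (hg1.norm.pow 2)).intervalIntegrable _ _
    have i4 : IntervalIntegrable
        (fun x => t * ‖compl N M (fun x => Bdiag v x - Bdiag w x) x‖ ^ 2)
        volume 0 (2 * Real.pi) := (continuous_const.mul (hg2.norm.pow 2)).intervalIntegrable _ _
    unfold normSq
    rw [← intervalIntegral.integral_const_mul, ← intervalIntegral.integral_const_mul,
      ← intervalIntegral.integral_const_mul, ← intervalIntegral.integral_const_mul,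
      ← intervalIntegral.integral_add i1 i2, ← intervalIntegral.integral_add (i1.add i2) i3,
      ← intervalIntegral.integral_add ((i1.add i2).add i3) i4]
    refine intervalIntegral.integral_mono Real.two_pi_pos.le ?_ (((i1.add i2).add i3).add i4) hpt
    exact (Complex.continuous_re.comp ((hF.sub (continuous_const.mul hBu)).mul
      he.star)).intervalIntegrable _ _
  have := mul_le_mul_of_nonneg_left hG2 ht
  linarith

lemma errRate_le {N : ℕ} {M : ℕ∞} {T : ℝ} {a : ℝ → ℤ → ℂ} {u : ℝ → ℝ → ℂ}
    (hM : (N : ℕ∞) ≤ M) (hu : IsFullSolution M T u) {K t : ℝ} (ht : t ∈ Icc 0 T)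
    (hvK : ∀ x, ‖resolved N a t x‖ ≤ K) (hwK : ∀ x, ‖proj N (u t) x‖ ≤ K)
    (huK : ∀ x, ‖u t x‖ ≤ K) :
    errRate N M a u t ≤ (10 * K ^ 4 + t * (33 * K ^ 8)) * errSq N a u t
      + 5 * K ^ 4 * normSq (compl N M (u t))
      + 1664 * t * normSq (compl N M (Bdiag (proj N (u t)))) := by
  have h := integral_force_le hM ht.1 (continuous_resolved N a t)
    (continuous_proj N (hu.continuous ht)) (hu.continuous ht) hvK hwK huK
  have hq : compl N M (u t) = fun x => u t x - proj N (u t) x := by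
    funext x; unfold compl; rw [hu.modes t ht]
  rw [hq]
  exact h

/-- As long as `N ‖v - Pu‖₂² ≤ 1` the error is at most `1` in the sup norm, and the constants of
the error estimate do not depend on `N`. -/
lemma errRate_le_of_small {N : ℕ} {M : ℕ∞} {T : ℝ} {a : ℝ → ℤ → ℂ} {u : ℝ → ℝ → ℂ}
    (hM : (N : ℕ∞) ≤ M) (hu : IsFullSolution M T u) {W t : ℝ} (ht : t ∈ Icc 0 T)
    (hwK : ∀ x, ‖proj N (u t) x‖ ≤ W) (huK : ∀ x, ‖u t x‖ ≤ W)
    (hE : N * errSq N a u t ≤ 1) :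
    errRate N M a u t ≤ (10 * (W + 1) ^ 4 + t * (33 * (W + 1) ^ 8)) * errSq N a u t
      + 5 * (W + 1) ^ 4 * normSq (compl N M (u t))
      + 1664 * t * normSq (compl N M (Bdiag (proj N (u t)))) := by
  refine errRate_le hM hu ht (fun x => ?_) (fun x => ?_) (fun x => ?_)
  · have h1 := norm_trigSum_sq_le N (fun k => a t k - coeff (u t) k) x
    unfold errSq at hE
    rw [← resolved_sub_proj] at h1
    have h2 : ‖resolved N a t x - proj N (u t) x‖ ≤ 1 := by
      rw [← sq_le_one_iff₀ (norm_nonneg _)]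
      exact h1.trans hE
    have h3 := norm_add_le (resolved N a t x - proj N (u t) x) (proj N (u t) x)
    rw [sub_add_cancel] at h3
    linarith [hwK x]
  · linarith [hwK x]
  · linarith [huK x]

lemma le_mul_of_hasDerivWithinAt_le {f f' : ℝ → ℝ} {T R : ℝ}
    (hf : ∀ t ∈ Icc 0 T, HasDerivWithinAt f (f' t) (Icc 0 T) t)
    (hb : ∀ t ∈ Icc 0 T, f' t ≤ R) {t : ℝ} (ht : t ∈ Icc 0 T) : f t ≤ f 0 + R * t := by
  refine image_le_of_deriv_right_le_deriv_boundary (a := 0) (b := T) (f' := f')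
    (B := fun t => f 0 + R * t) (B' := fun _ => R)
    (fun s hs => (hf s hs).continuousWithinAt) (fun s hs => ?_) (by simp) (by fun_prop)
    (fun s _ => ?_) (fun s hs => hb s (Ico_subset_Icc_self hs)) ht
  · exact (hf s (Ico_subset_Icc_self hs)).mono_of_mem_nhdsWithin
      (Icc_mem_nhdsGE_of_mem hs)
  · simpa using (((hasDerivAt_id s).const_mul R).const_add (f 0)).hasDerivWithinAt

/-- The `L²` norm of the `t`-model does not increase. -/
lemma IsTModel.normSq_le {N : ℕ} {M : ℕ∞} {T : ℝ} {a : ℝ → ℤ → ℂ} (hM : (N : ℕ∞) ≤ M)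
    (ha : IsTModel N M T a) {t : ℝ} (ht : t ∈ Icc 0 T) :
    normSq (resolved N a t) ≤ normSq (resolved N a 0) := by
  have h := le_mul_of_hasDerivWithinAt_le (R := 0) (fun s hs => ha.energy hM hs)
    (fun s hs => ?_) ht
  · linarith
  · nlinarith [normSq_nonneg (compl N M (Bdiag (resolved N a s))), hs.1]

lemma errSq_nonneg (N : ℕ) (a : ℝ → ℤ → ℂ) (u : ℝ → ℝ → ℂ) (t : ℝ) : 0 ≤ errSq N a u t :=
  normSq_nonneg _

lemma resolved_eq_proj {N : ℕ} {a : ℝ → ℤ → ℂ} {u : ℝ → ℝ → ℂ} {t : ℝ}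
    (h : ∀ k ∈ F N, a t k = coeff (u t) k) : resolved N a t = proj N (u t) :=
  funext fun x => by
    rw [proj_coe, resolved, trigSum, trigSum]
    exact Finset.sum_congr rfl fun k hk => by rw [h k hk]

lemma errSq_eq_zero {N : ℕ} {a : ℝ → ℤ → ℂ} {u : ℝ → ℝ → ℂ} {t : ℝ}
    (h : ∀ k ∈ F N, a t k = coeff (u t) k) : errSq N a u t = 0 := by
  simp [errSq, resolved_eq_proj h, normSq]

/-- A bound on the rate of change of the error that is polynomial in `N` and needs no smallness:
the `L²` norm of `v` is bounded by that of the initial datum, its sup norm by Bernstein's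
inequality. Here `L` stands for a bound on `‖u‖₂²`. -/
lemma errRate_le_pow {N : ℕ} {M : ℕ∞} {T : ℝ} {a : ℝ → ℤ → ℂ} {u : ℝ → ℝ → ℂ}
    (hM : (N : ℕ∞) ≤ M) (ha : IsTModel N M T a) (hu : IsFullSolution M T u)
    (h0 : ∀ k ∈ F N, a 0 k = coeff (u 0) k) {W L t : ℝ} (ht : t ∈ Icc 0 T)
    (hwW : ∀ x, ‖proj N (u t) x‖ ≤ W) (huW : ∀ t ∈ Icc 0 T, ∀ x, ‖u t x‖ ≤ W)
    (hL : L = 2 * Real.pi * W ^ 2) :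
    errRate N M a u t ≤ (45 * L + T * (132 * L + 1664 * (2 * Real.pi * W ^ 10)))
      * ((W + L + 1) * ((N : ℝ) + 1)) ^ 8 := by
  have hT0 : (0 : ℝ) ∈ Icc 0 T := ⟨le_rfl, ht.1.trans ht.2⟩
  have hW : 0 ≤ W := (norm_nonneg _).trans (hwW 0)
  have hL0 : 0 ≤ L := by rw [hL]; positivity
  have hN0 : (0 : ℝ) ≤ N := Nat.cast_nonneg N
  set K := (W + L + 1) * ((N : ℝ) + 1) with hK
  clear_value K
  have hKW : W + L + 1 ≤ K := hK ▸ le_mul_of_one_le_right (by positivity) (by linarith)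
  have hK1 : 1 ≤ K := by linarith
  have huc := hu.continuous ht
  have hu2 : ∀ s ∈ Icc 0 T, normSq (u s) ≤ L := fun s hs => by
    rw [hL]; exact normSq_le_of_norm_le (hu.continuous hs) (huW s hs)
  have hw2 : ∀ s ∈ Icc 0 T, normSq (proj N (u s)) ≤ L := fun s hs =>
    (normSq_trigSum_coeff_le (hu.continuous hs) _).trans (hu2 s hs)
  have hv2 : normSq (resolved N a t) ≤ L := by
    refine (ha.normSq_le hM ht).trans ?_
    rw [resolved_eq_proj h0]
    exact hw2 0 hT0
  have hvK : ∀ x, ‖resolved N a t x‖ ≤ K := by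
    intro x
    refine (sq_le_sq₀ (norm_nonneg _) (by linarith)).1 ?_
    calc ‖resolved N a t x‖ ^ 2 ≤ N * normSq (resolved N a t) := norm_trigSum_sq_le N (a t) x
      _ ≤ N * L := by gcongr
      _ ≤ ((L + 1) * ((N : ℝ) + 1)) ^ 2 := by
        nlinarith [mul_nonneg hN0 hL0, mul_nonneg (mul_nonneg hN0 hL0) hN0,
          mul_nonneg (mul_nonneg hN0 hL0) hL0, sq_nonneg (L * N)]
      _ ≤ K ^ 2 := by rw [hK]; gcongr; linarith
  have hwc : Continuous (proj N (u t)) := continuous_proj N huc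
  have hE : errSq N a u t ≤ 4 * L := by
    have hv := continuous_resolved N a t
    have h1 : errSq N a u t ≤ 2 * normSq (resolved N a t) + 2 * normSq (proj N (u t)) := by
      unfold errSq normSq
      rw [← intervalIntegral.integral_const_mul, ← intervalIntegral.integral_const_mul,
        ← intervalIntegral.integral_add (f := fun x => 2 * ‖resolved N a t x‖ ^ 2)
          (g := fun x => 2 * ‖proj N (u t) x‖ ^ 2)
          ((continuous_const.mul (hv.norm.pow 2)).intervalIntegrable _ _)
          ((continuous_const.mul (hwc.norm.pow 2)).intervalIntegrable _ _)]
      refine intervalIntegral.integral_mono Real.two_pi_pos.le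
        (((hv.sub hwc).norm.pow 2).intervalIntegrable _ _)
        (((continuous_const.mul (hv.norm.pow 2)).add
          (continuous_const.mul (hwc.norm.pow 2))).intervalIntegrable _ _) fun x => ?_
      have h1 := norm_sub_le (resolved N a t x) (proj N (u t) x)
      have h2 := pow_le_pow_left₀ (norm_nonneg _) h1 2
      simp only
      nlinarith [sq_nonneg (‖resolved N a t x‖ - ‖proj N (u t) x‖)]
    linarith [hw2 t ht]
  have hq : normSq (compl N M (u t)) ≤ L := (normSq_compl_le hM huc).trans (hu2 t ht)
  have hg : normSq (compl N M (Bdiag (proj N (u t)))) ≤ 2 * Real.pi * W ^ 10 := by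
    refine (normSq_compl_le hM (continuous_Bdiag hwc)).trans ?_
    have := normSq_le_of_norm_le (K := W ^ 5) (continuous_Bdiag hwc) fun x => by
      rw [norm_Bdiag]; exact pow_le_pow_left₀ (norm_nonneg _) (hwW x) 5
    rwa [← pow_mul] at this
  have h := errRate_le hM hu ht hvK (fun x => (hwW x).trans (by linarith))
    (fun x => (huW t ht x).trans (by linarith))
  have ht0 := ht.1
  have htT := ht.2
  have hK4 : K ^ 4 ≤ K ^ 8 := pow_le_pow_right₀ hK1 (by norm_num)
  have hK8 : 1 ≤ K ^ 8 := one_le_pow₀ hK1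
  have hT : 0 ≤ T := ht0.trans htT
  calc _ ≤ _ := h
    _ ≤ (10 * K ^ 8 + T * (33 * K ^ 8)) * (4 * L) + 5 * K ^ 8 * L
        + 1664 * T * (2 * Real.pi * W ^ 10 * K ^ 8) := by
      have hE0 := errSq_nonneg N a u t
      have hq0 := normSq_nonneg (compl N M (u t))
      have hg' : normSq (compl N M (Bdiag (proj N (u t)))) ≤ 2 * Real.pi * W ^ 10 * K ^ 8 :=
        hg.trans (le_mul_of_one_le_right (by positivity) hK8)
      gcongr
      exact normSq_nonneg _
    _ = _ := by ring


/-- An error `E` that has grown from `0` at a rate bounded by `R` and is no longer small satisfies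
`N⁻¹ < E ≤ 2Rt`, so that the bound `R` on the rate can be traded for a multiple of `t E²`. -/
lemma le_mul_sq_of_large {E D R N t : ℝ} (hR : 0 ≤ R) (hN : 0 ≤ N) (hD : D ≤ R)
    (hE : E ≤ 2 * R * t) (hNE : 1 < N * E) : D ≤ t * (2 * R ^ 2 * N ^ 3) * E ^ 2 := by
  have h1 : 1 ≤ (N * E) ^ 3 := one_le_pow₀ hNE.le
  calc D ≤ R := hD
    _ ≤ R * (N * E) ^ 3 := le_mul_of_one_le_right hR h1
    _ = R * N ^ 3 * E ^ 2 * E := by ring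
    _ ≤ R * N ^ 3 * E ^ 2 * (2 * R * t) := by gcongr
    _ = _ := by ring

/-! ### Convergence -/

/-- If `f` satisfies `f' ≤ 2α f + c` as long as `2Nf ≤ 1`, starts at `0`, and the barrier
`δ e^{(2α+1)t}` with `δ > c` stays in the range `2Nf ≤ 1`, then `f` stays below the barrier. -/
lemma le_exp_of_conditional_bound {f f' : ℝ → ℝ} {T α c δ N : ℝ} (hα : 0 ≤ α) (hc : 0 ≤ c)
    (hδ : c < δ) (hN : 0 ≤ N) (hf : ∀ t ∈ Icc 0 T, HasDerivWithinAt f (f' t) (Icc 0 T) t)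
    (hf0 : f 0 = 0)
    (hsmall : 2 * N * (δ * Real.exp ((2 * α + 1) * T)) ≤ 1)
    (hb : ∀ t ∈ Icc 0 T, 2 * N * f t ≤ 1 → f' t ≤ α * (2 * f t) + c) {t : ℝ}
    (ht : t ∈ Icc 0 T) : f t ≤ δ * Real.exp ((2 * α + 1) * t) := by
  refine image_le_of_deriv_right_lt_deriv_boundary (a := 0) (b := T) (f' := f')
    (B := fun t => δ * Real.exp ((2 * α + 1) * t))
    (B' := fun t => δ * (Real.exp ((2 * α + 1) * t) * (2 * α + 1)))
    (fun s hs => (hf s hs).continuousWithinAt) (fun s hs => ?_)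
    (by rw [hf0]; simpa using hc.trans hδ.le) (fun s => ?_) (fun s hs hfs => ?_) ht
  · exact (hf s (Ico_subset_Icc_self hs)).mono_of_mem_nhdsWithin (Icc_mem_nhdsGE_of_mem hs)
  · simpa using (((hasDerivAt_id s).const_mul (2 * α + 1)).exp).const_mul δ
  · have hδ0 : 0 < δ := hc.trans_lt hδ
    have h1 : Real.exp ((2 * α + 1) * s) ≤ Real.exp ((2 * α + 1) * T) := by
      gcongr; exact hs.2.le
    have h2 : 2 * N * f s ≤ 1 := by
      rw [hfs]; refine le_trans ?_ hsmall; gcongr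
    have h3 := hb s (Ico_subset_Icc_self hs) h2
    have h4 : 1 ≤ Real.exp ((2 * α + 1) * s) := by
      apply Real.one_le_exp
      have := hs.1
      positivity
    have h5 : δ ≤ f s := hfs ▸ le_mul_of_one_le_right hδ0.le h4
    have h6 : δ * (Real.exp ((2 * α + 1) * s) * (2 * α + 1)) = f s * (2 * α + 1) := by
      rw [hfs]; ring
    rw [h6]
    linarith

end NLS

theorem mainTheorem2 (T : ℝ) (hT : 0 < T)
    (M : ℕ → ℕ∞) (hM : ∀ N : ℕ, (N : ℕ∞) ≤ M N)
    (u : ℕ → ℝ → ℝ → ℂ)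
    (hu : ∀ N : ℕ, NLS.IsFullSolution (M N) T (u N))
    (hsmooth : ∀ m : ℕ, ∃ K : ℝ, ∀ N : ℕ, ∀ t ∈ Icc 0 T, ∀ x : ℝ,
      ‖iteratedDeriv m (u N t) x‖ ≤ K) :
    -- the differential inequality for the error
    (∃ (C₁ C₂ C₃ : ℕ → ℝ) (C₄ C₅ C₆ : ℝ),
      (∀ N, 0 ≤ C₁ N ∧ 0 ≤ C₂ N ∧ 0 ≤ C₃ N) ∧ 0 ≤ C₄ ∧ 0 ≤ C₅ ∧ 0 ≤ C₆ ∧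
      (∃ (K : ℝ) (p : ℕ), ∀ N : ℕ,
        C₁ N ≤ K * ((N : ℝ) + 1) ^ p ∧ C₂ N ≤ K * ((N : ℝ) + 1) ^ p ∧
          C₃ N ≤ K * ((N : ℝ) + 1) ^ p) ∧
      ∀ (N : ℕ) (a : ℝ → ℤ → ℂ), NLS.IsTModel N (M N) T a →
        (∀ k ∈ NLS.F N, a 0 k = NLS.coeff (u N 0) k) →
        ∀ t ∈ Icc 0 T, ∃ D : ℝ,
          HasDerivWithinAt (fun s => 1 / 2 * NLS.errSq N a (u N) s) D (Icc 0 T) t ∧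
          D ≤ t * C₁ N * NLS.errSq N a (u N) t ^ 4
            + t * C₂ N * NLS.errSq N a (u N) t ^ 3
            + t * C₃ N * NLS.errSq N a (u N) t ^ 2
            + (C₄ + t * C₅) * NLS.errSq N a (u N) t
            + C₆ * NLS.normSq (NLS.compl N (M N) (u N t))
            + 1664 * t *
              NLS.normSq (NLS.compl N (M N) (NLS.Bdiag (NLS.proj N (u N t))))) ∧
    -- convergence of the `t`-model, uniformly on `[0,T]`
    (∀ ε : ℝ, 0 < ε → ∃ N₀ : ℕ, ∀ N ≥ N₀, ∀ a : ℝ → ℤ → ℂ, NLS.IsTModel N (M N) T a →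
      (∀ k ∈ NLS.F N, a 0 k = NLS.coeff (u N 0) k) →
      ∀ t ∈ Icc 0 T, NLS.errSq N a (u N) t < ε) ∧
    -- the decay rate of the `L²` norm of the `t`-model
    (∀ (N : ℕ) (a : ℝ → ℤ → ℂ), NLS.IsTModel N (M N) T a → ∀ t ∈ Icc 0 T,
      HasDerivWithinAt (fun s => 1 / 2 * NLS.normSq (NLS.resolved N a s))
        (-t * NLS.normSq (NLS.compl N (M N) (NLS.Bdiag (NLS.resolved N a t))))
        (Icc 0 T) t ∧
      NLS.normSq (NLS.compl N (M N) (NLS.Bdiag (NLS.resolved N a t)))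
        = NLS.normSq (NLS.Gam N (M N) (NLS.resolved N a t))) := by
  open NLS in
  obtain ⟨K₀, hK₀⟩ := hsmooth 0
  obtain ⟨K₁, hK₁⟩ := hsmooth 1
  obtain ⟨K₂, hK₂⟩ := hsmooth 2
  simp only [iteratedDeriv_zero] at hK₀
  simp only [iteratedDeriv_one] at hK₁
  have hT0 : (0 : ℝ) ∈ Icc 0 T := ⟨le_rfl, hT.le⟩
  have hK₀0 : 0 ≤ K₀ := (norm_nonneg _).trans (hK₀ 0 0 hT0 0)
  have hK₂0 : 0 ≤ K₂ := (norm_nonneg _).trans (hK₂ 0 0 hT0 0)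
  -- `W` bounds the sup norms of `u` and of all its projections
  obtain ⟨W, hW⟩ : ∃ W, W = K₀ + K₂ * ∑' k : ℤ, 1 / (k : ℝ) ^ 2 := ⟨_, rfl⟩
  have hKW : K₀ ≤ W := by
    have : 0 ≤ ∑' k : ℤ, 1 / (k : ℝ) ^ 2 := tsum_nonneg fun k => by positivity
    rw [hW]
    exact le_add_of_nonneg_right (mul_nonneg hK₂0 this)
  have hW0 : 0 ≤ W := hK₀0.trans hKW
  have huW : ∀ N, ∀ t ∈ Icc 0 T, ∀ x, ‖u N t x‖ ≤ W := fun N t ht x => (hK₀ N t ht x).trans hKW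
  have hwW : ∀ N : ℕ, ∀ t ∈ Icc 0 T, ∀ x, ‖proj N (u N t) x‖ ≤ W := fun N t ht x => by
    rw [hW]; exact (hu N).norm_proj_le ht (hK₀ N t ht) (hK₂ N t ht) N x
  obtain ⟨L, hL⟩ : ∃ L, L = 2 * Real.pi * W ^ 2 := ⟨_, rfl⟩
  have hL0 : 0 ≤ L := by rw [hL]; positivity
  obtain ⟨A, hA⟩ : ∃ A, A = 45 * L + T * (132 * L + 1664 * (2 * Real.pi * W ^ 10)) := ⟨_, rfl⟩
  have hA0 : 0 ≤ A := by rw [hA]; positivity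
  obtain ⟨V, hV⟩ : ∃ V, V = W + L + 1 := ⟨_, rfl⟩
  obtain ⟨Y, hY⟩ : ∃ Y, Y = W + 1 := ⟨_, rfl⟩
  have hV0 : 0 ≤ V := by rw [hV]; positivity
  have hY0 : 0 ≤ Y := by rw [hY]; positivity
  have hder : ∀ N a, IsTModel N (M N) T a → ∀ t ∈ Icc 0 T,
      HasDerivWithinAt (fun s => 1 / 2 * errSq N a (u N) s) (errRate N (M N) a (u N) t)
        (Icc 0 T) t := fun N a ha t ht =>
    hasDerivWithinAt_errSq (hM N) ha (hu N) (hK₀ N) (hK₂ N) ht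
  refine ⟨⟨fun _ => 0, fun _ => 0, fun N => 2 * A ^ 2 * V ^ 16 * ((N : ℝ) + 1) ^ 19,
    10 * Y ^ 4, 33 * Y ^ 8, 5 * Y ^ 4, fun N => ⟨le_rfl, le_rfl, by positivity⟩,
    by positivity, by positivity, by positivity,
    ⟨2 * A ^ 2 * V ^ 16, 19, fun N => ⟨by positivity, by positivity, le_rfl⟩⟩, ?_⟩,
    ?_, ?_⟩
  · intro N a ha h0 t ht
    refine ⟨_, hder N a ha t ht, ?_⟩
    have ht0 := ht.1
    have hE0 := errSq_nonneg N a (u N) t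
    have hq0 := normSq_nonneg (compl N (M N) (u N t))
    have hg0 := normSq_nonneg (compl N (M N) (Bdiag (proj N (u N t))))
    rcases le_or_gt (N * errSq N a (u N) t) 1 with hs | hs
    · have h := errRate_le_of_small (hM N) (hu N) ht (hwW N t ht) (huW N t ht) hs
      rw [← hY] at h
      have : 0 ≤ t * (2 * A ^ 2 * V ^ 16 * ((N : ℝ) + 1) ^ 19)
        * errSq N a (u N) t ^ 2 := by positivity
      linarith
    · -- a large error can only occur after a time that is at least an inverse power of `N`
      obtain ⟨R, hR⟩ : ∃ R, R = A * (V * ((N : ℝ) + 1)) ^ 8 := ⟨_, rfl⟩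
      have hR0 : 0 ≤ R := by rw [hR]; positivity
      have hrate : ∀ s ∈ Icc 0 T, errRate N (M N) a (u N) s ≤ R := fun s hs => by
        rw [hR, hA, hV]
        exact errRate_le_pow (hM N) ha (hu N) h0 hs (hwW N s hs) (huW N) hL
      have hE := le_mul_of_hasDerivWithinAt_le (hder N a ha) hrate ht
      rw [errSq_eq_zero h0] at hE
      have h := le_mul_sq_of_large hR0 (Nat.cast_nonneg N) (hrate t ht)
        (show errSq N a (u N) t ≤ 2 * R * t by linarith) hs
      have hC : 2 * R ^ 2 * (N : ℝ) ^ 3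
          ≤ 2 * A ^ 2 * V ^ 16 * ((N : ℝ) + 1) ^ 19 := by
        have : (N : ℝ) ^ 3 ≤ ((N : ℝ) + 1) ^ 3 := by gcongr; linarith
        calc 2 * R ^ 2 * (N : ℝ) ^ 3 ≤ 2 * R ^ 2 * ((N : ℝ) + 1) ^ 3 := by gcongr
          _ = _ := by rw [hR]; ring
      have h' : t * (2 * R ^ 2 * (N : ℝ) ^ 3) * errSq N a (u N) t ^ 2
          ≤ t * (2 * A ^ 2 * V ^ 16 * ((N : ℝ) + 1) ^ 19)
            * errSq N a (u N) t ^ 2 := by gcongr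
      have : 0 ≤ (10 * Y ^ 4 + t * (33 * Y ^ 8)) * errSq N a (u N) t := by positivity
      have : 0 ≤ 5 * Y ^ 4 * normSq (compl N (M N) (u N t)) := by positivity
      have : 0 ≤ 1664 * t * normSq (compl N (M N) (Bdiag (proj N (u N t)))) := by positivity
      linarith
  · intro ε hε
    obtain ⟨L₁, hL₁⟩ : ∃ L₁, L₁ = 2 * Real.pi * K₁ ^ 2 := ⟨_, rfl⟩
    obtain ⟨α, hα⟩ : ∃ α, α = 10 * Y ^ 4 + T * (33 * Y ^ 8) := ⟨_, rfl⟩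
    obtain ⟨c, hc⟩ : ∃ c, c = 5 * Y ^ 4 * (4 * L₁) + 1664 * T * (100 * W ^ 8 * L₁) :=
      ⟨_, rfl⟩
    have hL₁0 : 0 ≤ L₁ := by rw [hL₁]; positivity
    have hα0 : 0 ≤ α := by rw [hα]; positivity
    have hc0 : 0 ≤ c := by rw [hc]; positivity
    obtain ⟨G, hG⟩ : ∃ G, G = 2 * ((c + 1) * Real.exp ((2 * α + 1) * T)) := ⟨_, rfl⟩
    have hG0 : 0 < G := by rw [hG]; positivity
    obtain ⟨N₀, hN₀⟩ := exists_nat_gt (max G (G / ε))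
    refine ⟨N₀ + 1, fun N hN a ha h0 t ht => ?_⟩
    have hNr : (N₀ : ℝ) + 1 ≤ N := by exact_mod_cast hN
    have hN₀0 : (0 : ℝ) ≤ N₀ := Nat.cast_nonneg N₀
    have hN1 : (1 : ℝ) ≤ N := by linarith
    have hNpos : (0 : ℝ) < N := by linarith
    have hGN : G ≤ N := by linarith [le_max_left G (G / ε)]
    have hGε : G < ε * N := by
      have : G / ε < N := by linarith [le_max_right G (G / ε)]
      rw [div_lt_iff₀ hε] at this
      linarith
    have hderiv : ∀ s ∈ Icc 0 T, normSq (deriv (u N s)) ≤ L₁ := fun s hs => by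
      rw [hL₁]
      exact normSq_le_of_norm_le ((hu N).contDiff_deriv hs).continuous (hK₁ N s hs)
    have hbar := le_exp_of_conditional_bound (f := fun s => 1 / 2 * errSq N a (u N) s)
      (T := T) (α := α) (c := c / (N : ℝ) ^ 2) (δ := (c + 1) / (N : ℝ) ^ 2) (N := N)
      hα0 (by positivity) (by gcongr; linarith) hNpos.le (hder N a ha)
      (by rw [errSq_eq_zero h0, mul_zero]) (by
        have : 2 * (N : ℝ) * ((c + 1) / (N : ℝ) ^ 2 * Real.exp ((2 * α + 1) * T)) = G / N := by
          rw [hG]; field_simp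
        rw [this, div_le_one hNpos]
        exact hGN) (fun s hs hsm => by
        have hE0 := errSq_nonneg N a (u N) s
        have h := errRate_le_of_small (hM N) (hu N) hs (hwW N s hs) (huW N s hs) (by linarith)
        rw [← hY] at h
        have hq : normSq (compl N (M N) (u N s)) ≤ 4 * L₁ / (N : ℝ) ^ 2 := by
          rw [le_div_iff₀ (by positivity), mul_comm]
          exact ((hu N).sq_mul_normSq_compl_le (hM N) hs).trans (by gcongr; exact hderiv s hs)
        have hg : normSq (compl N (M N) (Bdiag (proj N (u N s))))
            ≤ 100 * W ^ 8 * L₁ / (N : ℝ) ^ 2 := by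
          rw [le_div_iff₀ (by positivity), mul_comm]
          exact ((hu N).sq_mul_normSq_compl_Bdiag_le (hM N) hs (hwW N s hs)).trans
            (by gcongr; exact hderiv s hs)
        have hs0 := hs.1
        have hsT := hs.2
        calc _ ≤ _ := h
          _ ≤ (10 * Y ^ 4 + T * (33 * Y ^ 8)) * errSq N a (u N) s
              + 5 * Y ^ 4 * (4 * L₁ / (N : ℝ) ^ 2)
              + 1664 * T * (100 * W ^ 8 * L₁ / (N : ℝ) ^ 2) := by
            gcongr
            exact normSq_nonneg _
          _ = _ := by rw [hα, hc]; ring) ht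
    have hexp : Real.exp ((2 * α + 1) * t) ≤ Real.exp ((2 * α + 1) * T) := by
      gcongr; exact ht.2
    have hfin : errSq N a (u N) t ≤ G / (N : ℝ) ^ 2 := by
      calc errSq N a (u N) t = 2 * (1 / 2 * errSq N a (u N) t) := by ring
        _ ≤ 2 * ((c + 1) / (N : ℝ) ^ 2 * Real.exp ((2 * α + 1) * T)) := by
          gcongr 2 * ?_
          exact hbar.trans (by gcongr)
        _ = G / (N : ℝ) ^ 2 := by rw [hG]; ring
    refine hfin.trans_lt ?_
    rw [div_lt_iff₀ (by positivity)]
    calc G < ε * N := hGε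
      _ ≤ ε * (N : ℝ) ^ 2 := by gcongr; exact le_self_pow₀ hN1 two_ne_zero
  · intro N a ha t ht
    exact ⟨ha.energy (hM N) ht, normSq_Gam N (M N) _⟩
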